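/- Let $\omega>0$ and let $G$ be the linear quadratic output system $\dot x=Ax+Bu$, $y=Cx+(x^TM_ix)_{i=1}^p$ with real matrices $A\in\mathbb R^{n\times n}$, $B\in\mathbb R^{n\times m}$, $C\in\mathbb R^{p\times n}$ and symmetric $M_i\in\mathbb R^{n\times n}$; let $G_k$ be a reduced system of order $k$ with real matrices $(A_k,B_k,C_k,M_{k,1},\dots,M_{k,p})$, $M_{k,i}$ symmetric. Assume that $A$ and $A_k$ are Hurwitz. For a realization $(A,B,C,M_i)$ put $G_1(s)=C(sI-A)^{-1}B$, $G_{2,i}(s_1,s_2)=B^T(s_1I-A)^{-*}M_i(s_2I-A)^{-1}B$, $$\|G\|_{\mathcal H_{2,\omega}}=\Big[\operatorname{trace}\Big(\tfrac1{2\pi}\int_{-\omega}^{\omega}G_1^*(j\nu)G_1(j\nu)\,d\nu+\tfrac1{(2\pi)^2}\int_{-\omega}^{\omega}\!\int_{-\omega}^{\omega}\sum_{i=1}^pG_{2,i}^*(j\nu_1,j\nu_2)G_{2,i}(j\nu_1,j\nu_2)\,d\nu_1d\nu_2\Big)\Big]^{1/2},$$ $$P_\omega=\tfrac1{2\pi}\int_{-\omega}^{\omega}(j\nu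 I-A)^{-1}BB^T(j\nu I-A)^{-*}d\nu,\qquad Y_\omega=\tfrac1{2\pi}\int_{-\omega}^{\omega}(j\nu I-A)^{-*}C^TC(j\nu I-A)^{-1}d\nu,$$ $$Z_\omega=\tfrac1{2\pi}\int_{-\omega}^{\omega}(j\nu I-A)^{-*}\Big(\sum_{i=1}^pM_iP_\omega M_i\Big)(j\nu I-A)^{-1}d\nu .$$ The error system $G-G_k$ has the realization $A_e=\operatorname{diag}(A,A_k)$, $B_e=\begin{bmatrix}B\\B_k\end{bmatrix}$, $C_e=[\,C\;\,-C_k\,]$, $M_{e,i}=\operatorname{diag}(M_i,-M_{k,i})$. Partition its matrices $P_{e,\omega},Y_{e,\omega},Z_{e,\omega}$ accordingly as $$P_{e,\omega}=\begin{bmatrix}P_\omega&P_{12,\omega}\\P_{12,\omega}^*&P_{k,\omega}\end{bmatrix},\quad Y_{e,\omega}=\begin{bmatrix}Y_\omega&-Y_{12,\omega}\\-Y_{12,\omega}^*&Y_{k,\omega}\end{bmatrix},\quad Z_{e,\omega}=\begin{bmatrix}Z_\omega&-Z_{12,\omega}\\-Z_{12,\omega}^*&Z_{k,\omega}\end{bmatrix},$$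 and let $Q_{12,\omega}=Y_{12,\omega}+Z_{12,\omega}$, $Q_{k,\omega}=Y_{k,\omega}+Z_{k,\omega}$. Let $P_{12},P_k,\bar Z_{12},\bar Z_k$ be the solutions of $$AP_{12}+P_{12}A_k^T+BB_k^T=0,\qquad A_kP_k+P_kA_k^T+B_kB_k^T=0,$$ $$A^T\bar Z_{12}+\bar Z_{12}A_k+\sum_{i=1}^pM_iP_{12,\omega}M_{k,i}=0,\qquad A_k^T\bar Z_k+\bar Z_kA_k+\sum_{i=1}^pM_{k,i}P_{k,\omega}M_{k,i}=0,$$ and put $$V=B_kB^T\bar Z_{12}-B_kB_k^T\bar Z_k+P_{12}^TC^TC_k-P_kC_k^TC_k+P_{12}^T\sum_{i=1}^pM_iP_{12,\omega}M_{k,i}-P_k\sum_{i=1}^pM_{k,i}P_{k,\omega}M_{k,i},$$ $$W=\operatorname{Re}\Big(\tfrac j\pi\,\mathcal L(-j\omega I-A_k,V)\Big),\qquad \mathcal L(X,E)=\int_0^1\big(t(X-I)+I\big)^{-1}E\big(t(X-I)+I\big)^{-1}dt$$ ($\mathcal L(X,E)$ is the Fréchet derivative of the principal matrix logarithm at $X$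 in the direction $E$; the real part is entrywise), and $$L_\omega=-Q_{12,\omega}^*(P_{12}-P_{12,\omega})-(\bar Z_{12}-Z_{12,\omega})^*P_{12,\omega}+Q_{k,\omega}(P_k-P_{k,\omega})+(\bar Z_k-Z_{k,\omega})P_{k,\omega}+W^* .$$ If $(A_k,B_k,C_k,M_{k,1},\dots,M_{k,p})$ is a local optimum (local minimum or local maximum) of $\|G-G_k\|_{\mathcal H_{2,\omega}}^2$ over all real reduced matrices of these sizes with $A_k$ Hurwitz and $M_{k,1},\dots,M_{k,p}$ symmetric, then $$-(Y_{12,\omega}+2Z_{12,\omega})^*P_{12,\omega}+(Y_{k,\omega}+2Z_{k,\omega})P_{k,\omega}+L_\omega=0,$$ $$-P_{12,\omega}^*M_iP_{12,\omega}+P_{k,\omega}M_{k,i}P_{k,\omega}=0\quad(i=1,\dots,p),$$ $$-(Y_{12,\omega}+2Z_{12,\omega})^*B+(Y_{k,\omega}+2Z_{k,\omega})B_k=0,$$ $$-CP_{12,\omega}+C_kP_{k,\omega}=0 .$$ -/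

import Mathlib

/-- Realizations `(A, B, C, M₁, …, M_p)` of linear quadratic output systems
`x' = A x + B u`, `y = C x + (xᵀ M_i x)_i`, with states indexed by `ι`, inputs by `μ` and
outputs by `o`. As a finite product of real matrix spaces it carries the usual topology. -/
abbrev LQOSystem (ι μ o : Type*) : Type _ :=
  Matrix ι ι ℝ × Matrix ι μ ℝ × Matrix o ι ℝ × (o → Matrix ι ι ℝ)

/-- A real matrix seen as a complex one. -/
noncomputable def toC {ι κ : Type*} (X : Matrix ι κ ℝ) : Matrix ι κ ℂ :=
  X.map Complex.ofReal

/-- A real square matrix is Hurwitz if all its complex eigenvalues have negative real part. -/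
def IsHurwitz {ι : Type*} [Fintype ι] [DecidableEq ι] (A : Matrix ι ι ℝ) : Prop :=
  ∀ z ∈ spectrum ℂ (toC A), z.re < 0

/-- Entrywise integral of a matrix-valued function. -/
noncomputable def matIntegral {ι κ : Type*} (a b : ℝ) (f : ℝ → Matrix ι κ ℂ) : Matrix ι κ ℂ :=
  Matrix.of fun i j => ∫ ν in a..b, f ν i j

/-- The resolvent `(s I - A)⁻¹`. -/
noncomputable def res {ι : Type*} [Fintype ι] [DecidableEq ι] (A : Matrix ι ι ℝ) (s : ℂ) :
    Matrix ι ι ℂ :=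
  (s • (1 : Matrix ι ι ℂ) - toC A)⁻¹

/-- The solution `X` of the Sylvester equation `A X + X B + D = 0` when it has exactly one
solution (it does whenever the spectra of `A` and `-B` are disjoint). -/
noncomputable def sylvesterSol {ι κ : Type*} [Fintype ι] [Fintype κ]
    (A : Matrix ι ι ℂ) (B : Matrix κ κ ℂ) (D : Matrix ι κ ℂ) : Matrix ι κ ℂ :=
  open Classical in
  if h : ∃! X : Matrix ι κ ℂ, A * X + X * B + D = 0 then h.choose else 0

/-- `∫₀¹ (t (X - I) + I)⁻¹ E (t (X - I) + I)⁻¹ dt`: the Fréchet derivative at `X`, in the direction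
`E`, of the principal matrix logarithm (`X` without eigenvalues in `(-∞, 0]`). -/
noncomputable def logFrechet {κ : Type*} [Fintype κ] [DecidableEq κ] (X E : Matrix κ κ ℂ) :
    Matrix κ κ ℂ :=
  matIntegral 0 1 fun t =>
    ((t : ℂ) • (X - 1) + 1)⁻¹ * E * ((t : ℂ) • (X - 1) + 1)⁻¹

namespace LQOSystem

section
variable {ι μ o : Type*}

/-- The state matrix `A`. -/
def A (S : LQOSystem ι μ o) : Matrix ι ι ℝ := S.1

/-- The input matrix `B`. -/
def B (S : LQOSystem ι μ o) : Matrix ι μ ℝ := S.2.1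

/-- The matrix `C` of the linear part of the output. -/
def C (S : LQOSystem ι μ o) : Matrix o ι ℝ := S.2.2.1

/-- The matrices `M_i` of the quadratic part of the output. -/
def M (S : LQOSystem ι μ o) (i : o) : Matrix ι ι ℝ := S.2.2.2 i

end

section
variable {ι μ o : Type*} [Fintype ι] [DecidableEq ι] [Fintype μ] [Fintype o]

/-- Standing assumptions: `A` is Hurwitz and every `M_i` is symmetric. -/
def IsAdmissible (S : LQOSystem ι μ o) : Prop :=
  IsHurwitz S.A ∧ ∀ i, (S.M i).IsSymm

/-- The transfer function `G₁(s) = C (s I - A)⁻¹ B`. -/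
noncomputable def G₁ (S : LQOSystem ι μ o) (s : ℂ) : Matrix o μ ℂ :=
  toC S.C * res S.A s * toC S.B

/-- The transfer function `G_{2,i}(s₁, s₂) = Bᵀ (s₁ I - A)^{-*} M_i (s₂ I - A)⁻¹ B`. -/
noncomputable def G₂ (S : LQOSystem ι μ o) (i : o) (s₁ s₂ : ℂ) : Matrix μ μ ℂ :=
  toC S.B.transpose * (res S.A s₁).conjTranspose * toC (S.M i) * res S.A s₂ * toC S.B

/-- The frequency-limited `H₂` norm on `[0, ω]`. -/
noncomputable def h2Norm (ω : ℝ) (S : LQOSystem ι μ o) : ℝ :=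
  Real.sqrt (Complex.re (Matrix.trace (
    (1 / (2 * Real.pi : ℂ)) • matIntegral (-ω) ω (fun ν =>
        (S.G₁ (Complex.I * ν)).conjTranspose * S.G₁ (Complex.I * ν))
    + (1 / (2 * Real.pi : ℂ) ^ 2) • matIntegral (-ω) ω (fun ν₁ => matIntegral (-ω) ω (fun ν₂ =>
        ∑ i, (S.G₂ i (Complex.I * ν₁) (Complex.I * ν₂)).conjTranspose
          * S.G₂ i (Complex.I * ν₁) (Complex.I * ν₂))))))

/-- The frequency-limited controllability Gramian `P_ω`. -/
noncomputable def gramP (ω : ℝ) (S : LQOSystem ι μ o) : Matrix ι ι ℂ :=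
  (1 / (2 * Real.pi : ℂ)) • matIntegral (-ω) ω (fun ν =>
    res S.A (Complex.I * ν) * toC S.B * toC S.B.transpose
      * (res S.A (Complex.I * ν)).conjTranspose)

/-- The part `Y_ω` of the frequency-limited observability Gramian `Q_ω = Y_ω + Z_ω`. -/
noncomputable def gramY (ω : ℝ) (S : LQOSystem ι μ o) : Matrix ι ι ℂ :=
  (1 / (2 * Real.pi : ℂ)) • matIntegral (-ω) ω (fun ν =>
    (res S.A (Complex.I * ν)).conjTranspose * toC S.C.transpose * toC S.C
      * res S.A (Complex.I * ν))

/-- The part `Z_ω` of the frequency-limited observability Gramian `Q_ω = Y_ω + Z_ω`. -/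
noncomputable def gramZ (ω : ℝ) (S : LQOSystem ι μ o) : Matrix ι ι ℂ :=
  (1 / (2 * Real.pi : ℂ)) • matIntegral (-ω) ω (fun ν =>
    (res S.A (Complex.I * ν)).conjTranspose * (∑ i, toC (S.M i) * S.gramP ω * toC (S.M i))
      * res S.A (Complex.I * ν))

end

section
variable {ι κ μ o : Type*}

/-- The realization of the error system `G - G_k`. -/
def err (G : LQOSystem ι μ o) (R : LQOSystem κ μ o) : LQOSystem (ι ⊕ κ) μ o :=
  (Matrix.fromBlocks G.A 0 0 R.A, Matrix.fromRows G.B R.B, Matrix.fromCols G.C (-R.C),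
    fun i => Matrix.fromBlocks (G.M i) 0 0 (-R.M i))

variable [Fintype ι] [DecidableEq ι] [Fintype κ] [DecidableEq κ] [Fintype μ] [Fintype o]
variable (ω : ℝ) (G : LQOSystem ι μ o) (R : LQOSystem κ μ o)

/-- `P_{12,ω}`, from `P_{e,ω} = [P_ω, P_{12,ω}; P_{12,ω}^*, P_{k,ω}]`. -/
noncomputable def P₁₂ω : Matrix ι κ ℂ := ((G.err R).gramP ω).toBlocks₁₂

/-- `P_{k,ω}`. -/
noncomputable def Pₖω : Matrix κ κ ℂ := ((G.err R).gramP ω).toBlocks₂₂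

/-- `Y_{12,ω}`, from `Y_{e,ω} = [Y_ω, -Y_{12,ω}; -Y_{12,ω}^*, Y_{k,ω}]`. -/
noncomputable def Y₁₂ω : Matrix ι κ ℂ := -((G.err R).gramY ω).toBlocks₁₂

/-- `Y_{k,ω}`. -/
noncomputable def Yₖω : Matrix κ κ ℂ := ((G.err R).gramY ω).toBlocks₂₂

/-- `Z_{12,ω}`, from `Z_{e,ω} = [Z_ω, -Z_{12,ω}; -Z_{12,ω}^*, Z_{k,ω}]`. -/
noncomputable def Z₁₂ω : Matrix ι κ ℂ := -((G.err R).gramZ ω).toBlocks₁₂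

/-- `Z_{k,ω}`. -/
noncomputable def Zₖω : Matrix κ κ ℂ := ((G.err R).gramZ ω).toBlocks₂₂

/-- `Q_{12,ω} = Y_{12,ω} + Z_{12,ω}`. -/
noncomputable def Q₁₂ω : Matrix ι κ ℂ := G.Y₁₂ω ω R + G.Z₁₂ω ω R

/-- `Q_{k,ω} = Y_{k,ω} + Z_{k,ω}`. -/
noncomputable def Qₖω : Matrix κ κ ℂ := G.Yₖω ω R + G.Zₖω ω R

/-- `P₁₂`: solution of `A P₁₂ + P₁₂ A_kᵀ + B B_kᵀ = 0`. -/
noncomputable def P₁₂ : Matrix ι κ ℂ :=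
  sylvesterSol (toC G.A) (toC R.A.transpose) (toC G.B * toC R.B.transpose)

/-- `P_k`: solution of `A_k P_k + P_k A_kᵀ + B_k B_kᵀ = 0`. -/
noncomputable def Pₖ (R : LQOSystem κ μ o) : Matrix κ κ ℂ :=
  sylvesterSol (toC R.A) (toC R.A.transpose) (toC R.B * toC R.B.transpose)

/-- `Z̄₁₂`: solution of `Aᵀ Z̄₁₂ + Z̄₁₂ A_k + ∑ M_i P_{12,ω} M_{k,i} = 0`. -/
noncomputable def Zbar₁₂ : Matrix ι κ ℂ :=
  sylvesterSol (toC G.A.transpose) (toC R.A) (∑ i, toC (G.M i) * G.P₁₂ω ω R * toC (R.M i))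

/-- `Z̄_k`: solution of `A_kᵀ Z̄_k + Z̄_k A_k + ∑ M_{k,i} P_{k,ω} M_{k,i} = 0`. -/
noncomputable def Zbarₖ : Matrix κ κ ℂ :=
  sylvesterSol (toC R.A.transpose) (toC R.A) (∑ i, toC (R.M i) * G.Pₖω ω R * toC (R.M i))

/-- The matrix `V` in whose direction the logarithm is differentiated. -/
noncomputable def V : Matrix κ κ ℂ :=
  toC R.B * toC G.B.transpose * G.Zbar₁₂ ω R
    - toC R.B * toC R.B.transpose * G.Zbarₖ ω R
    + (G.P₁₂ R).transpose * toC G.C.transpose * toC R.C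
    - R.Pₖ * toC R.C.transpose * toC R.C
    + (G.P₁₂ R).transpose * (∑ i, toC (G.M i) * G.P₁₂ω ω R * toC (R.M i))
    - R.Pₖ * (∑ i, toC (R.M i) * G.Pₖω ω R * toC (R.M i))

/-- `W = Re ((j/π) 𝓛(-jω I - A_k, V))`, the real part being taken entrywise. -/
noncomputable def W : Matrix κ κ ℂ :=
  toC (((Complex.I / Real.pi) •
    logFrechet (-(Complex.I * ω) • (1 : Matrix κ κ ℂ) - toC R.A) (G.V ω R)).map Complex.re)

/-- The correction term
`L_ω = -Q_{12,ω}^* P̃₁₂ - Z̃₁₂^* P_{12,ω} + Q_{k,ω} P̃_k + Z̃_k P_{k,ω} + W^*`, where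
`P̃₁₂ = P₁₂ - P_{12,ω}`, `P̃_k = P_k - P_{k,ω}`, `Z̃₁₂ = Z̄₁₂ - Z_{12,ω}`, `Z̃_k = Z̄_k - Z_{k,ω}`. -/
noncomputable def Lω : Matrix κ κ ℂ :=
  -((G.Q₁₂ω ω R).conjTranspose * (G.P₁₂ R - G.P₁₂ω ω R))
    - (G.Zbar₁₂ ω R - G.Z₁₂ω ω R).conjTranspose * G.P₁₂ω ω R
    + G.Qₖω ω R * (R.Pₖ - G.Pₖω ω R)
    + (G.Zbarₖ ω R - G.Zₖω ω R) * G.Pₖω ω R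
    + (G.W ω R).conjTranspose

end

end LQOSystem

/-! Write `P` for the frequency-limited controllability Gramian of the error system and `x(ν) = (jν
- A)⁻¹ B`. Since `G_{2,i}(jν₁, jν₂) = x(ν₁)ᴴ M_i x(ν₂)`, the trace of the double integral factors
through two independent copies of the kernel `x xᴴ`, and the squared norm becomes `tr (P Cᵀ C) + tr
(P ∑ M_i P M_i)` (`trace_h2Norm`, `h2Norm_sq`). This is a polynomial in `P`, `C`, `M_i`, and `P` is
differentiable along every line `S + t H` because being Hurwitz is an open condition.

The second trace is quadratic in `P` with a self-adjoint coefficient, so the derivative of `P` is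
paired with `Cᵀ C + 2 ∑ M_i P M_i`; this is the origin of the combination `Y + 2 Z`. Cyclicity of
the trace turns half the directional derivative into pairings of `H.A`, `H.B`, `H.C`, `H.M i` with
explicit matrices (`hasDerivAt_h2Norm_sq`). A perturbation of the reduced system moves only the
second blocks of the error system, so only the corresponding blocks of those matrices matter
(`directional_deriv_eq_zero`). They are real, and the one paired with `H.M i` is symmetric, so each
may be used, up to transposition, as a test direction; the derivative is then a squared Frobenius
norm and the matrix vanishes. This already gives the conditions for `M_{k,i}`, `B_k` and `C_k`.

For `A_k` the gradient is an integral of a product of kernel, weight and resolvent. On the imaginary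
axis a Sylvester equation `A X + X Bᵀ + D = 0` acts as a partial fraction rule: `(s - A)⁻¹ D (s -
B)^{-*} = X (s - B)^{-*} + (s - A)⁻¹ X`. Applied with `P₁₂`, `P_k`, `Z̄₁₂`, `Z̄_k`, it splits the
integrand into constants times Gramian integrands, plus one remainder `-(jν - A_k)⁻¹ V (jν - A_k)⁻¹`
(`stateSens_integrand`).

The remainder integrates to `W`. Indeed the `ν`-derivative of `𝓛(-jν - A_k, V)` is `j (-jν - A_k)⁻¹
V (-jν - A_k)⁻¹`, and the value at `ν = 0` is real, so it disappears from `Re ((j/π) ·)`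
(`hasMatDerivAt_logFrechet`, `re_logFrechet`). Taking adjoints and regrouping gives the first
condition with the correction `L_ω` (`stateSens_err_conjTranspose`). -/

open Matrix

set_option linter.unusedSectionVars false

/-! ### Entrywise integrals of matrix-valued functions -/

section MatIntegral

variable {ι κ l : Type*} {a b : ℝ}

theorem Continuous.entry {X : Type*} [TopologicalSpace X] {f : X → Matrix ι κ ℂ}
    (hf : Continuous f) (i : ι) (j : κ) : Continuous fun x => f x i j :=
  (continuous_apply j).comp ((continuous_apply i).comp hf)

theorem ContinuousOn.entry {X : Type*} [TopologicalSpace X] {s : Set X} {f : X → Matrix ι κ ℂ}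
    (hf : ContinuousOn f s) (i : ι) (j : κ) : ContinuousOn (fun x => f x i j) s :=
  (continuous_apply j).comp_continuousOn ((continuous_apply i).comp_continuousOn hf)

theorem ContinuousOn.matrixMul {X : Type*} [TopologicalSpace X] [Fintype κ] {s : Set X}
    {f : X → Matrix ι κ ℂ} {g : X → Matrix κ l ℂ}
    (hf : ContinuousOn f s) (hg : ContinuousOn g s) : ContinuousOn (fun x => f x * g x) s := by
  rw [continuousOn_iff_continuous_domRestrict] at *
  exact hf.matrix_mul hg

theorem ContinuousOn.matrixInv {X : Type*} [TopologicalSpace X] [Fintype ι] [DecidableEq ι]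
    {s : Set X} {f : X → Matrix ι ι ℂ} (hf : ContinuousOn f s) (h : ∀ x ∈ s, IsUnit (f x)) :
    ContinuousOn (fun x => (f x)⁻¹) s := by
  rw [continuousOn_iff_continuous_domRestrict] at *
  have hdet : ∀ x : s, (s.domRestrict f x).det ≠ 0 := fun x =>
    ((Matrix.isUnit_iff_isUnit_det _).1 (h x x.2)).ne_zero
  have : s.domRestrict (fun x => (f x)⁻¹) =
      fun x => ((s.domRestrict f x).det)⁻¹ • (s.domRestrict f x).adjugate := by
    funext x
    simp [Matrix.inv_def, Set.domRestrict]
  rw [this]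
  exact (hf.matrix_det.inv₀ hdet).smul hf.matrix_adjugate

theorem Continuous.matrixInv {X : Type*} [TopologicalSpace X] [Fintype ι] [DecidableEq ι]
    {f : X → Matrix ι ι ℂ} (hf : Continuous f) (h : ∀ x, IsUnit (f x)) :
    Continuous (fun x => (f x)⁻¹) :=
  continuousOn_univ.1 (hf.continuousOn.matrixInv fun x _ => h x)

@[simp] theorem matIntegral_apply (f : ℝ → Matrix ι κ ℂ) (i : ι) (j : κ) :
    matIntegral a b f i j = ∫ ν in a..b, f ν i j := rfl

theorem matIntegral_congr {f g : ℝ → Matrix ι κ ℂ} (h : ∀ ν, f ν = g ν) :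
    matIntegral a b f = matIntegral a b g := by
  rw [funext h]

theorem matIntegral_add {f g : ℝ → Matrix ι κ ℂ} (hf : Continuous f) (hg : Continuous g) :
    matIntegral a b (fun ν => f ν + g ν) = matIntegral a b f + matIntegral a b g := by
  ext i j
  exact intervalIntegral.integral_add ((hf.entry i j).intervalIntegrable _ _)
    ((hg.entry i j).intervalIntegrable _ _)

theorem matIntegral_add₅ {f₁ f₂ f₃ f₄ f₅ : ℝ → Matrix ι κ ℂ} (h₁ : Continuous f₁)
    (h₂ : Continuous f₂) (h₃ : Continuous f₃) (h₄ : Continuous f₄) (h₅ : Continuous f₅) :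
    matIntegral a b (fun ν => f₁ ν + f₂ ν + f₃ ν + f₄ ν + f₅ ν) =
      matIntegral a b f₁ + matIntegral a b f₂ + matIntegral a b f₃ + matIntegral a b f₄ +
        matIntegral a b f₅ := by
  have h₁₂ : Continuous fun ν => f₁ ν + f₂ ν := h₁.add h₂
  have h₁₃ : Continuous fun ν => f₁ ν + f₂ ν + f₃ ν := h₁₂.add h₃
  have h₁₄ : Continuous fun ν => f₁ ν + f₂ ν + f₃ ν + f₄ ν := h₁₃.add h₄
  rw [matIntegral_add h₁₄ h₅, matIntegral_add h₁₃ h₄, matIntegral_add h₁₂ h₃,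
    matIntegral_add h₁ h₂]

theorem matIntegral_const_mul [Fintype ι] (K : Matrix l ι ℂ) {f : ℝ → Matrix ι κ ℂ}
    (hf : Continuous f) : matIntegral a b (fun ν => K * f ν) = K * matIntegral a b f := by
  ext i j
  simp only [matIntegral_apply, Matrix.mul_apply]
  have h : ∀ q ∈ Finset.univ, IntervalIntegrable (fun ν => K i q * f ν q j)
      MeasureTheory.volume a b :=
    fun q _ => (continuous_const.mul (hf.entry q j)).intervalIntegrable _ _
  rw [intervalIntegral.integral_finsetSum h]
  simp

theorem matIntegral_mul_const [Fintype κ] (K : Matrix κ l ℂ) {f : ℝ → Matrix ι κ ℂ}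
    (hf : Continuous f) : matIntegral a b (fun ν => f ν * K) = matIntegral a b f * K := by
  ext i j
  simp only [matIntegral_apply, Matrix.mul_apply]
  have h : ∀ q ∈ Finset.univ, IntervalIntegrable (fun ν => f ν i q * K q j)
      MeasureTheory.volume a b :=
    fun q _ => ((hf.entry i q).mul continuous_const).intervalIntegrable _ _
  rw [intervalIntegral.integral_finsetSum h]
  simp

theorem matIntegral_smul (c : ℂ) (f : ℝ → Matrix ι κ ℂ) :
    matIntegral a b (fun ν => c • f ν) = c • matIntegral a b f := by
  ext i j
  simp

theorem matIntegral_neg (f : ℝ → Matrix ι κ ℂ) :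
    matIntegral a b (fun ν => -f ν) = -matIntegral a b f := by
  ext i j
  simp

theorem trace_matIntegral [Fintype ι] {f : ℝ → Matrix ι ι ℂ} (hf : Continuous f) :
    (matIntegral a b f).trace = ∫ ν in a..b, (f ν).trace := by
  simp only [Matrix.trace, Matrix.diag, matIntegral_apply]
  rw [intervalIntegral.integral_finsetSum fun q _ => (hf.entry q q).intervalIntegrable _ _]

theorem intervalIntegral_star (f : ℝ → ℂ) :
    ∫ ν in a..b, star (f ν) = star (∫ ν in a..b, f ν) := by
  simp only [intervalIntegral, star_sub]
  congr 1 <;> exact integral_conj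

theorem matIntegral_conjTranspose (f : ℝ → Matrix ι κ ℂ) :
    matIntegral a b (fun ν => (f ν)ᴴ) = (matIntegral a b f)ᴴ := by
  ext i j
  simp only [matIntegral_apply, Matrix.conjTranspose_apply]
  exact intervalIntegral_star _

theorem matIntegral_map_star (f : ℝ → Matrix ι κ ℂ) :
    matIntegral a b (fun ν => (f ν).map star) = (matIntegral a b f).map star := by
  ext i j
  simp only [matIntegral_apply, Matrix.map_apply]
  exact intervalIntegral_star _

theorem matIntegral_comp_neg (f : ℝ → Matrix ι κ ℂ) :
    matIntegral (-a) a (fun ν => f (-ν)) = matIntegral (-a) a f := by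
  ext i j
  simp only [matIntegral_apply]
  rw [intervalIntegral.integral_comp_neg (fun ν => f ν i j), neg_neg]

/-- A function with the symmetry `f (-ν) = conj (f ν)` has a real integral over `[-a, a]`. -/
theorem matIntegral_map_star_eq_self {f : ℝ → Matrix ι κ ℂ}
    (hf : ∀ ν, (f ν).map star = f (-ν)) :
    (matIntegral (-a) a f).map star = matIntegral (-a) a f := by
  rw [← matIntegral_map_star, matIntegral_congr hf, matIntegral_comp_neg]

end MatIntegral

/-! ### Entrywise derivatives of matrix-valued functions -/

section HasMatDerivAt

variable {ι κ l : Type*}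

/-- The matrix-valued function `f` has the entrywise derivative `f'` at `t`. -/
def HasMatDerivAt (f : ℝ → Matrix ι κ ℂ) (f' : Matrix ι κ ℂ) (t : ℝ) : Prop :=
  ∀ i j, HasDerivAt (fun u => f u i j) (f' i j) t

namespace HasMatDerivAt

variable {f g : ℝ → Matrix ι κ ℂ} {f' g' : Matrix ι κ ℂ} {t : ℝ}

theorem const (K : Matrix ι κ ℂ) (t : ℝ) : HasMatDerivAt (fun _ => K) 0 t :=
  fun i j => hasDerivAt_const t (K i j)

theorem congr_deriv (hf : HasMatDerivAt f f' t) (h : f' = g') : HasMatDerivAt f g' t :=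
  h ▸ hf

theorem finset_sum {α : Type*} (s : Finset α) {F : α → ℝ → Matrix ι κ ℂ}
    {F' : α → Matrix ι κ ℂ} (h : ∀ q ∈ s, HasMatDerivAt (F q) (F' q) t) :
    HasMatDerivAt (fun u => ∑ q ∈ s, F q u) (∑ q ∈ s, F' q) t := by
  intro i j
  simp only [Matrix.sum_apply]
  exact HasDerivAt.fun_sum fun q hq => h q hq i j

theorem mul [Fintype κ] {g : ℝ → Matrix κ l ℂ} {g' : Matrix κ l ℂ}
    (hf : HasMatDerivAt f f' t) (hg : HasMatDerivAt g g' t) :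
    HasMatDerivAt (fun u => f u * g u) (f' * g t + f t * g') t := by
  intro i j
  simp only [Matrix.mul_apply, Matrix.add_apply, ← Finset.sum_add_distrib]
  exact HasDerivAt.fun_sum fun q _ => (hf i q).mul (hg q j)

theorem smul {c : ℝ → ℂ} {c' : ℂ} (hc : HasDerivAt c c' t) (hf : HasMatDerivAt f f' t) :
    HasMatDerivAt (fun u => c u • f u) (c' • f t + c t • f') t :=
  fun i j => hc.mul (hf i j)

theorem const_smul (c : ℂ) (hf : HasMatDerivAt f f' t) :
    HasMatDerivAt (fun u => c • f u) (c • f') t :=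
  fun i j => (hf i j).const_mul c

theorem conjTranspose (hf : HasMatDerivAt f f' t) :
    HasMatDerivAt (fun u => (f u)ᴴ) f'ᴴ t :=
  fun i j => (hf j i).star

theorem trace [Fintype ι] {f : ℝ → Matrix ι ι ℂ} {f' : Matrix ι ι ℂ}
    (hf : HasMatDerivAt f f' t) : HasDerivAt (fun u => (f u).trace) f'.trace t :=
  HasDerivAt.fun_sum fun q _ => hf q q

theorem continuousAt (hf : HasMatDerivAt f f' t) : ContinuousAt f t :=
  continuousAt_pi.2 fun i => continuousAt_pi.2 fun j => (hf i j).continuousAt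

/-- `(X⁻¹)' = -X⁻¹ X' X⁻¹`. -/
theorem inv [Fintype ι] [DecidableEq ι] {f : ℝ → Matrix ι ι ℂ} {f' : Matrix ι ι ℂ}
    (hf : HasMatDerivAt f f' t) (h : IsUnit (f t)) :
    HasMatDerivAt (fun u => (f u)⁻¹) (-((f t)⁻¹ * f' * (f t)⁻¹)) t := by
  have hdet : (f t).det ≠ 0 := ((Matrix.isUnit_iff_isUnit_det _).1 h).ne_zero
  have hcont := hf.continuousAt
  have hdetc : ContinuousAt (fun u => (f u).det) t :=
    (Continuous.matrix_det continuous_id).continuousAt.comp hcont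
  have hne : ∀ᶠ u in nhds t, (f u).det ≠ 0 := hdetc.eventually_ne hdet
  have hinvc : ContinuousAt (fun u => (f u)⁻¹) t := by
    have : (fun u => (f u)⁻¹) = fun u => ((f u).det)⁻¹ • (f u).adjugate := by
      funext u
      simp [Matrix.inv_def]
    rw [this]
    exact (hdetc.inv₀ hdet).smul
      ((Continuous.matrix_adjugate continuous_id).continuousAt.comp hcont)
  -- By `X⁻¹ - Y⁻¹ = -X⁻¹ (X - Y) Y⁻¹`, this product is the difference quotient of the inverse at
  -- every `u` near `t` with `f u` invertible; its limit is therefore the derivative.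
  have hslope : Filter.Tendsto
      (fun u => -((f u)⁻¹ * (Matrix.of fun i j => slope (fun u => f u i j) t u) * (f t)⁻¹))
      (nhdsWithin t {t}ᶜ) (nhds (-((f t)⁻¹ * f' * (f t)⁻¹))) := by
    refine Filter.Tendsto.neg ?_
    have h1 : Filter.Tendsto (fun u => (f u)⁻¹) (nhdsWithin t {t}ᶜ) (nhds (f t)⁻¹) :=
      hinvc.tendsto.mono_left nhdsWithin_le_nhds
    have h2 : Filter.Tendsto (fun u => Matrix.of fun i j => slope (fun u => f u i j) t u)
        (nhdsWithin t {t}ᶜ) (nhds f') :=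
      tendsto_pi_nhds.2 fun i => tendsto_pi_nhds.2 fun j => (hf i j).tendsto_slope
    exact (h1.mul h2).mul tendsto_const_nhds
  intro i j
  rw [hasDerivAt_iff_tendsto_slope]
  refine (tendsto_pi_nhds.1 (tendsto_pi_nhds.1 hslope i) j).congr' ?_
  filter_upwards [nhdsWithin_le_nhds hne] with u hu
  have key : (f u)⁻¹ - (f t)⁻¹ = -((f u)⁻¹ * (f u - f t) * (f t)⁻¹) := by
    rw [Matrix.mul_sub, Matrix.sub_mul, Matrix.mul_assoc (f u)⁻¹ (f t),
      Matrix.nonsing_inv_mul _ (isUnit_iff_ne_zero.2 hu),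
      Matrix.mul_nonsing_inv _ (isUnit_iff_ne_zero.2 hdet)]
    simp
  have hs : (Matrix.of fun i j => slope (fun u => f u i j) t u) =
      ((u - t)⁻¹ : ℝ) • (f u - f t) := by
    ext i j
    simp [slope_def_module]
  rw [hs]
  simp only [slope_def_module, Matrix.mul_smul, Matrix.smul_mul]
  have := congrFun (congrFun key i) j
  simp only [Matrix.sub_apply] at this
  rw [this]
  simp

/-- Differentiation under the integral sign. -/
theorem matIntegral {a b ε : ℝ} (hε : 0 < ε) {F F' : ℝ → ℝ → Matrix ι κ ℂ}
    (hF : ∀ u ∈ Metric.ball t ε, ∀ ν ∈ Set.uIcc a b,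
      HasMatDerivAt (fun u => F u ν) (F' u ν) u)
    (hFc : ∀ u ∈ Metric.ball t ε, ContinuousOn (F u) (Set.uIcc a b))
    (hF'c : ContinuousOn (Function.uncurry F') (Metric.ball t ε ×ˢ Set.uIcc a b)) :
    HasMatDerivAt (fun u => matIntegral a b (F u)) (matIntegral a b (F' t)) t := by
  intro i j
  -- Halving the radius gives a compact product, on which the jointly continuous derivative is
  -- bounded; the bound is the constant dominating function.
  have hsub : Metric.closedBall t (ε / 2) ⊆ Metric.ball t ε :=
    Metric.closedBall_subset_ball (by linarith)
  have hK : IsCompact (Metric.closedBall t (ε / 2) ×ˢ Set.uIcc a b) :=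
    (isCompact_closedBall _ _).prod isCompact_uIcc
  obtain ⟨C, hC⟩ := hK.exists_bound_of_continuousOn
    ((hF'c.entry i j).mono (Set.prod_mono hsub le_rfl))
  have hpar : ContinuousOn (fun ν => F' t ν i j) (Set.uIcc a b) :=
    (hF'c.entry i j).comp (f := fun ν => (t, ν)) (by fun_prop)
      fun ν hν => ⟨Metric.mem_ball_self hε, hν⟩
  refine (intervalIntegral.hasDerivAt_integral_of_dominated_loc_of_deriv_le
    (F := fun u ν => F u ν i j) (F' := fun u ν => F' u ν i j) (bound := fun _ => C)
    (s := Metric.closedBall t (ε / 2)) (Metric.closedBall_mem_nhds _ (by linarith))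
    ?_ ?_ ?_ ?_ ?_ ?_).2
  · filter_upwards [Metric.ball_mem_nhds t hε] with u hu
    exact (intervalIntegrable_iff.1 ((hFc u hu).entry i j).intervalIntegrable).1
  · exact ((hFc t (Metric.mem_ball_self hε)).entry i j).intervalIntegrable
  · exact (intervalIntegrable_iff.1 hpar.intervalIntegrable).1
  · exact Filter.Eventually.of_forall fun ν hν u hu =>
      hC (u, ν) ⟨hu, Set.uIoc_subset_uIcc hν⟩
  · exact intervalIntegrable_const
  · exact Filter.Eventually.of_forall fun ν hν u hu =>
      hF u (hsub hu) ν (Set.uIoc_subset_uIcc hν) i j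

end HasMatDerivAt

/-- The fundamental theorem of calculus for matrix-valued functions. -/
theorem matIntegral_eq_sub_of_hasMatDerivAt {a b : ℝ} {f f' : ℝ → Matrix ι κ ℂ}
    (h : ∀ t ∈ Set.uIcc a b, HasMatDerivAt f (f' t) t) (hf' : ContinuousOn f' (Set.uIcc a b)) :
    matIntegral a b f' = f b - f a := by
  ext i j
  exact intervalIntegral.integral_eq_sub_of_hasDerivAt (fun t ht => h t ht i j)
    (hf'.entry i j).intervalIntegrable

end HasMatDerivAt

/-! ### Real matrices as complex matrices -/

section ToC

variable {ι κ l : Type*}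

@[simp] theorem toC_apply (X : Matrix ι κ ℝ) (i : ι) (j : κ) : toC X i j = (X i j : ℂ) := rfl

theorem toC_add (X Y : Matrix ι κ ℝ) : toC (X + Y) = toC X + toC Y := by
  ext; simp

theorem toC_neg (X : Matrix ι κ ℝ) : toC (-X) = -toC X := by
  ext; simp

theorem toC_smul (t : ℝ) (X : Matrix ι κ ℝ) : toC (t • X) = (t : ℂ) • toC X := by
  ext; simp

@[simp] theorem toC_zero : toC (0 : Matrix ι κ ℝ) = 0 := by
  ext; simp

theorem toC_transpose (X : Matrix ι κ ℝ) : toC Xᵀ = (toC X)ᵀ := rfl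

@[simp] theorem toC_conjTranspose (X : Matrix ι κ ℝ) : (toC X)ᴴ = toC Xᵀ := by
  ext; simp

@[simp] theorem toC_map_star (X : Matrix ι κ ℝ) : (toC X).map star = toC X := by
  ext; simp

/-- Invariance under entrywise conjugation is the working form of "the complex matrix `X` is real":
it passes through products, sums, inverses and symmetric integrals. -/
theorem eq_toC_of_map_star {X : Matrix ι κ ℂ} (h : X.map star = X) : toC (X.map Complex.re) = X := by
  ext i j
  exact Complex.conj_eq_iff_re.1 (congrFun (congrFun h i) j)

theorem map_star_mul [Fintype κ] (X : Matrix ι κ ℂ) (Y : Matrix κ l ℂ) :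
    (X * Y).map star = X.map star * Y.map star := by
  ext; simp [Matrix.mul_apply]

theorem map_star_add (X Y : Matrix ι κ ℂ) : (X + Y).map star = X.map star + Y.map star := by
  ext; simp

theorem map_star_sub (X Y : Matrix ι κ ℂ) : (X - Y).map star = X.map star - Y.map star := by
  ext; simp

theorem map_star_neg (X : Matrix ι κ ℂ) : (-X).map star = -X.map star := by
  ext; simp

theorem map_star_sum {α : Type*} (s : Finset α) (X : α → Matrix ι κ ℂ) :
    (∑ q ∈ s, X q).map star = ∑ q ∈ s, (X q).map star := by
  ext; simp [Matrix.sum_apply]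

theorem map_star_conjTranspose (X : Matrix ι κ ℂ) : Xᴴ.map star = (X.map star)ᴴ := rfl

theorem map_star_smul (c : ℂ) (X : Matrix ι κ ℂ) :
    (c • X).map star = star c • X.map star := by
  ext; simp

theorem map_star_inv [Fintype ι] [DecidableEq ι] (X : Matrix ι ι ℂ) :
    X⁻¹.map star = (X.map star)⁻¹ := by
  -- Entrywise conjugation is the conjugate transpose followed by the transpose, and both commute
  -- with inversion.
  change (X⁻¹)ᴴᵀ = (Xᴴᵀ)⁻¹
  rw [Matrix.conjTranspose_nonsing_inv, Matrix.transpose_nonsing_inv]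

theorem conjTranspose_eq_transpose_of_map_star {X : Matrix ι κ ℂ} (h : X.map star = X) :
    Xᴴ = Xᵀ := by
  conv_rhs => rw [← h]
  rfl

end ToC

/-! ### Hurwitz matrices and their resolvents -/

section Hurwitz

variable {ι κ : Type*} [Fintype ι] [DecidableEq ι] [Fintype κ] [DecidableEq κ]

/-- The form in which stability is used: the resolvent exists on the closed right half-plane, in
particular on the imaginary axis. -/
theorem isHurwitz_iff_isUnit {A : Matrix ι ι ℝ} :
    IsHurwitz A ↔ ∀ s : ℂ, 0 ≤ s.re → IsUnit (s • (1 : Matrix ι ι ℂ) - toC A) := by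
  simp only [IsHurwitz, spectrum.mem_iff, Algebra.algebraMap_eq_smul_one]
  exact forall_congr' fun s => ⟨fun h hs => by_contra fun h' => absurd (h h') (not_lt.2 hs),
    fun h h' => lt_of_not_ge fun hs => h' (h hs)⟩

theorem IsHurwitz.transpose {A : Matrix ι ι ℝ} (hA : IsHurwitz A) : IsHurwitz Aᵀ := by
  rw [isHurwitz_iff_isUnit] at *
  intro s hs
  have := (Matrix.isUnit_transpose (A := s • (1 : Matrix ι ι ℂ) - toC A)).2 (hA s hs)
  simpa [toC_transpose] using this

/-- Upper hemicontinuity of the spectrum: the open left half-plane contains the spectrum of `A`,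
hence that of every nearby matrix. The norm chosen inside serves only to make the matrices a Banach
algebra. -/
theorem IsHurwitz.eventually {A : Matrix ι ι ℝ} (hA : IsHurwitz A) (H : Matrix ι ι ℝ) :
    ∀ᶠ t : ℝ in nhds 0, IsHurwitz (A + t • H) := by
  let : NormedRing (Matrix ι ι ℂ) := Matrix.linftyOpNormedRing
  let : NormedAlgebra ℂ (Matrix ι ι ℂ) := Matrix.linftyOpNormedAlgebra
  have h := (upperHemicontinuous_spectrum ℂ (Matrix ι ι ℂ)) (toC A)
  have h2 : ∀ᶠ X in nhds (toC A), spectrum ℂ X ⊆ {z | z.re < 0} := by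
    have hU : IsOpen {z : ℂ | z.re < 0} := isOpen_lt Complex.continuous_re continuous_const
    filter_upwards [upperHemicontinuousAt_iff_forall_isOpen.1 h _ hU hA] with X hX
    exact hX
  have hc : Continuous fun t : ℝ => toC (A + t • H) := by
    simp only [toC_add, toC_smul]
    exact continuous_const.add (Complex.continuous_ofReal.smul continuous_const)
  have h3 := hc.tendsto 0
  simp only [zero_smul, add_zero] at h3
  exact h3.eventually h2

theorem isHurwitz_fromBlocks {A : Matrix ι ι ℝ} {D : Matrix κ κ ℝ} (hA : IsHurwitz A)
    (hD : IsHurwitz D) : IsHurwitz (Matrix.fromBlocks A 0 0 D) := by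
  rw [isHurwitz_iff_isUnit] at *
  intro s hs
  have : s • (1 : Matrix (ι ⊕ κ) (ι ⊕ κ) ℂ) - toC (Matrix.fromBlocks A 0 0 D) =
      Matrix.fromBlocks (s • 1 - toC A) 0 0 (s • 1 - toC D) := by
    rw [← Matrix.fromBlocks_one, Matrix.fromBlocks_smul]
    ext (i | i) (j | j) <;> simp
  rw [this, Matrix.isUnit_fromBlocks_zero₂₁]
  exact ⟨hA s hs, hD s hs⟩

theorem res_fromBlocks {A : Matrix ι ι ℝ} {D : Matrix κ κ ℝ} (hA : IsHurwitz A)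
    (hD : IsHurwitz D) {s : ℂ} (hs : 0 ≤ s.re) :
    res (Matrix.fromBlocks A 0 0 D) s = Matrix.fromBlocks (res A s) 0 0 (res D s) := by
  rw [isHurwitz_iff_isUnit] at *
  refine Matrix.inv_eq_right_inv ?_
  have : s • (1 : Matrix (ι ⊕ κ) (ι ⊕ κ) ℂ) - toC (Matrix.fromBlocks A 0 0 D) =
      Matrix.fromBlocks (s • 1 - toC A) 0 0 (s • 1 - toC D) := by
    rw [← Matrix.fromBlocks_one, Matrix.fromBlocks_smul]
    ext (i | i) (j | j) <;> simp
  rw [this, Matrix.fromBlocks_multiply]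
  simp only [res, Matrix.mul_zero, Matrix.zero_mul, add_zero, zero_add]
  rw [Matrix.mul_nonsing_inv _ ((Matrix.isUnit_iff_isUnit_det _).1 (hA s hs)),
    Matrix.mul_nonsing_inv _ ((Matrix.isUnit_iff_isUnit_det _).1 (hD s hs)),
    Matrix.fromBlocks_one]

theorem mul_res {A : Matrix ι ι ℝ} (hA : IsHurwitz A) {s : ℂ} (hs : 0 ≤ s.re) :
    (s • (1 : Matrix ι ι ℂ) - toC A) * res A s = 1 :=
  Matrix.mul_nonsing_inv _ ((Matrix.isUnit_iff_isUnit_det _).1 (isHurwitz_iff_isUnit.1 hA s hs))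

theorem res_mul {A : Matrix ι ι ℝ} (hA : IsHurwitz A) {s : ℂ} (hs : 0 ≤ s.re) :
    res A s * (s • (1 : Matrix ι ι ℂ) - toC A) = 1 :=
  Matrix.nonsing_inv_mul _ ((Matrix.isUnit_iff_isUnit_det _).1 (isHurwitz_iff_isUnit.1 hA s hs))

theorem res_map_star (A : Matrix ι ι ℝ) (s : ℂ) : (res A s).map star = res A (star s) := by
  rw [res, map_star_inv, map_star_sub, map_star_smul, toC_map_star, res]
  simp

theorem continuous_res {A : Matrix ι ι ℝ} (hA : IsHurwitz A) :
    Continuous fun ν : ℝ => res A (Complex.I * ν) := by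
  refine Continuous.matrixInv ?_ fun ν => isHurwitz_iff_isUnit.1 hA _ (by simp)
  fun_prop

end Hurwitz

/-! ### Sylvester equations -/

section Sylvester

variable {ι κ : Type*} [Fintype ι] [DecidableEq ι] [Fintype κ] [DecidableEq κ]

theorem aeval_mul_eq_mul_aeval {A : Matrix ι ι ℂ} {B : Matrix κ κ ℂ} {X : Matrix ι κ ℂ}
    (h : A * X = X * B) (p : Polynomial ℂ) :
    Polynomial.aeval A p * X = X * Polynomial.aeval B p := by
  induction p using Polynomial.induction_on' with
  | add p q hp hq => simp [Matrix.add_mul, Matrix.mul_add, hp, hq]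
  | monomial d c =>
    have hpow : A ^ d * X = X * B ^ d := by
      induction d with
      | zero => simp
      | succ d ih => rw [pow_succ, Matrix.mul_assoc, h, ← Matrix.mul_assoc, ih, Matrix.mul_assoc,
          pow_succ]
    simp [Polynomial.aeval_monomial, Algebra.algebraMap_eq_smul_one, hpow]

/-- `X` intertwines `A` and `-B`, so with `χ` the characteristic polynomial of `A`, Cayley–Hamilton
gives `0 = χ(A) X = X χ(-B)`. The spectra of `A` and `-B` lie in opposite open half-planes, so
`χ(-B)` is invertible by spectral mapping. -/
theorem eq_zero_of_sylvester {A : Matrix ι ι ℝ} {B : Matrix κ κ ℝ} (hA : IsHurwitz A)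
    (hB : IsHurwitz B) {X : Matrix ι κ ℂ} (h : toC A * X + X * toC B = 0) : X = 0 := by
  -- The spectral mapping step needs a nonempty spectrum, which fails for matrices of size zero.
  rcases isEmpty_or_nonempty κ with hκ | hκ
  · ext i j
    exact hκ.elim j
  have h1 : toC A * X = X * (-toC B) := by
    rw [Matrix.mul_neg]
    exact eq_neg_of_add_eq_zero_left h
  have h2 := aeval_mul_eq_mul_aeval h1 (toC A).charpoly
  rw [Matrix.aeval_self_charpoly, Matrix.zero_mul] at h2
  have hu : IsUnit (Polynomial.aeval (-toC B) (toC A).charpoly) := by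
    by_contra hn
    rw [← spectrum.zero_mem_iff ℂ, spectrum.map_polynomial_aeval_of_nonempty _ _
      (spectrum.nonempty_of_isAlgClosed_of_finiteDimensional ℂ _)] at hn
    obtain ⟨z, hz, hz0⟩ := hn
    have hzA : z ∈ spectrum ℂ (toC A) := Matrix.mem_spectrum_iff_isRoot_charpoly.2 hz0
    have hzB : -z ∈ spectrum ℂ (toC B) := by
      have := Set.neg_mem_neg.2 hz
      rwa [spectrum.neg_eq, neg_neg] at this
    have h3 := hA z hzA
    have h4 := hB _ hzB
    simp only [Complex.neg_re] at h4
    linarith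
  obtain ⟨u, hu⟩ := hu
  rw [← hu] at h2
  calc X = X * (u : Matrix κ κ ℂ) * ((u⁻¹ : (Matrix κ κ ℂ)ˣ) : Matrix κ κ ℂ) := by
        rw [Matrix.mul_assoc, Units.mul_inv, Matrix.mul_one]
    _ = 0 := by rw [← h2, Matrix.zero_mul]

/-- The Sylvester operator is an injective endomorphism of a finite-dimensional space, hence
bijective. -/
theorem existsUnique_sylvester {A : Matrix ι ι ℝ} {B : Matrix κ κ ℝ} (hA : IsHurwitz A)
    (hB : IsHurwitz B) (D : Matrix ι κ ℂ) :
    ∃! X : Matrix ι κ ℂ, toC A * X + X * toC B + D = 0 := by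
  let L : Matrix ι κ ℂ →ₗ[ℂ] Matrix ι κ ℂ :=
    { toFun := fun X => toC A * X + X * toC B
      map_add' := fun X Y => by rw [Matrix.mul_add, Matrix.add_mul]; abel
      map_smul' := fun c X => by simp }
  have hinj : Function.Injective L :=
    (injective_iff_map_eq_zero L).2 fun X hX => eq_zero_of_sylvester hA hB hX
  obtain ⟨X, hX⟩ := LinearMap.injective_iff_surjective.1 hinj (-D)
  refine ⟨X, ?_, fun Y hY => hinj ?_⟩
  · change L X + D = 0
    rw [hX, neg_add_cancel]
  · rw [hX]
    exact eq_neg_of_add_eq_zero_left hY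

theorem sylvesterSol_spec {A : Matrix ι ι ℝ} {B : Matrix κ κ ℝ} (hA : IsHurwitz A)
    (hB : IsHurwitz B) (D : Matrix ι κ ℂ) :
    toC A * sylvesterSol (toC A) (toC B) D + sylvesterSol (toC A) (toC B) D * toC B + D = 0 := by
  have h := existsUnique_sylvester hA hB D
  rw [sylvesterSol, dif_pos h]
  exact h.choose_spec.1

/-- With real data the conjugate of the solution solves the same equation, so uniqueness makes the
solution real. -/
theorem sylvesterSol_map_star {A : Matrix ι ι ℝ} {B : Matrix κ κ ℝ} (hA : IsHurwitz A)
    (hB : IsHurwitz B) {D : Matrix ι κ ℂ} (hD : D.map star = D) :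
    (sylvesterSol (toC A) (toC B) D).map star = sylvesterSol (toC A) (toC B) D := by
  have h := sylvesterSol_spec hA hB D
  refine (existsUnique_sylvester hA hB D).unique ?_ h
  have h' := congrArg (fun X => X.map star) h
  rwa [map_star_add, map_star_add, map_star_mul, map_star_mul, hD, toC_map_star, toC_map_star,
    Matrix.map_zero _ (star_zero ℂ)] at h'

end Sylvester

/-! ### The Fréchet derivative of the logarithm along vertical lines -/

section LogFrechet

variable {κ : Type*} [DecidableEq κ]

/-- The point `t (X - 1) + 1` of the segment from `1` to `X = -jν - A`. -/
noncomputable def logSegment (A : Matrix κ κ ℝ) (ν t : ℝ) : Matrix κ κ ℂ :=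
  (t : ℂ) • ((-(Complex.I * ν) • (1 : Matrix κ κ ℂ) - toC A) - 1) + 1

theorem continuous_logSegment (A : Matrix κ κ ℝ) :
    Continuous fun q : ℝ × ℝ => logSegment A q.1 q.2 := by
  unfold logSegment
  fun_prop

theorem hasMatDerivAt_logSegment_fst (A : Matrix κ κ ℝ) (ν t : ℝ) :
    HasMatDerivAt (fun u => logSegment A u t) (-((t : ℂ) * Complex.I) • (1 : Matrix κ κ ℂ)) ν := by
  intro i j
  have h := (((((Complex.ofRealCLM.hasDerivAt (x := ν)).const_mul Complex.I).neg.mul_const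
    ((1 : Matrix κ κ ℂ) i j)).sub_const (toC A i j)).sub_const ((1 : Matrix κ κ ℂ) i j)).const_mul
    (t : ℂ) |>.add_const ((1 : Matrix κ κ ℂ) i j)
  refine h.congr_deriv ?_
  simp
  ring

theorem hasMatDerivAt_logSegment_snd (A : Matrix κ κ ℝ) (ν t : ℝ) :
    HasMatDerivAt (fun u => logSegment A ν u)
      ((-(Complex.I * ν) • (1 : Matrix κ κ ℂ) - toC A) - 1) t := by
  intro i j
  have h := ((Complex.ofRealCLM.hasDerivAt (x := t)).mul_const
    (((-(Complex.I * ν) • (1 : Matrix κ κ ℂ) - toC A) - 1) i j)).add_const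
    ((1 : Matrix κ κ ℂ) i j)
  refine h.congr_deriv ?_
  simp

variable [Fintype κ]

/-- For `t > 0` the point equals `t (s - A)` with `s = (1 - t)/t - jν` in the closed right
half-plane; for `t = 0` it is the identity. -/
theorem isUnit_logSegment {A : Matrix κ κ ℝ} (hA : IsHurwitz A) (ν : ℝ) {t : ℝ}
    (ht : t ∈ Set.Icc (0 : ℝ) 1) : IsUnit (logSegment A ν t) := by
  rcases ht.1.eq_or_lt with h | h
  · simp [logSegment, ← h]
  · have hne : (t : ℂ) ≠ 0 := by exact_mod_cast h.ne'
    have hu := isHurwitz_iff_isUnit.1 hA (((1 - t) / t : ℝ) - Complex.I * ν) (by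
      have : 0 ≤ (1 - t) / t := div_nonneg (by linarith [ht.2]) h.le
      simpa using this)
    have heq : logSegment A ν t = (Units.mk0 (t : ℂ) hne) •
        ((((1 - t) / t : ℝ) - Complex.I * ν : ℂ) • (1 : Matrix κ κ ℂ) - toC A) := by
      ext i j
      simp only [logSegment, Units.smul_mk0, Matrix.add_apply, Matrix.smul_apply,
        Matrix.sub_apply, smul_eq_mul]
      push_cast
      field_simp
      ring
    rw [heq]
    exact hu.smul _

/-- The integrand of `logFrechet (-jν - A) E`. -/
noncomputable def logIntegrand (A : Matrix κ κ ℝ) (E : Matrix κ κ ℂ) (ν t : ℝ) : Matrix κ κ ℂ :=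
  (logSegment A ν t)⁻¹ * E * (logSegment A ν t)⁻¹

/-- The derivative of `logIntegrand A E ν t` with respect to `ν`. -/
noncomputable def logIntegrandDeriv (A : Matrix κ κ ℝ) (E : Matrix κ κ ℂ) (ν t : ℝ) :
    Matrix κ κ ℂ :=
  ((t : ℂ) * Complex.I) •
    ((logSegment A ν t)⁻¹ * (logSegment A ν t)⁻¹ * E * (logSegment A ν t)⁻¹ +
      (logSegment A ν t)⁻¹ * E * ((logSegment A ν t)⁻¹ * (logSegment A ν t)⁻¹))

theorem continuousOn_logSegment_inv {A : Matrix κ κ ℝ} (hA : IsHurwitz A) :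
    ContinuousOn (fun q : ℝ × ℝ => (logSegment A q.1 q.2)⁻¹) (Set.univ ×ˢ Set.Icc 0 1) :=
  (continuous_logSegment A).continuousOn.matrixInv fun q hq => isUnit_logSegment hA q.1 hq.2

theorem continuousOn_logIntegrand {A : Matrix κ κ ℝ} (hA : IsHurwitz A) (E : Matrix κ κ ℂ) :
    ContinuousOn (Function.uncurry (logIntegrand A E)) (Set.univ ×ˢ Set.Icc 0 1) := by
  have hinv := continuousOn_logSegment_inv hA
  exact (hinv.matrixMul continuousOn_const).matrixMul hinv

theorem continuousOn_logIntegrandDeriv {A : Matrix κ κ ℝ} (hA : IsHurwitz A) (E : Matrix κ κ ℂ) :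
    ContinuousOn (Function.uncurry (logIntegrandDeriv A E)) (Set.univ ×ˢ Set.Icc 0 1) := by
  have hinv := continuousOn_logSegment_inv hA
  have hs : ContinuousOn (fun q : ℝ × ℝ => (q.2 : ℂ) * Complex.I)
      (Set.univ ×ˢ Set.Icc (0 : ℝ) 1) := by fun_prop
  exact hs.smul ((((hinv.matrixMul hinv).matrixMul continuousOn_const).matrixMul hinv).add
    ((hinv.matrixMul continuousOn_const).matrixMul (hinv.matrixMul hinv)))

theorem hasMatDerivAt_logIntegrand {A : Matrix κ κ ℝ} (hA : IsHurwitz A) (E : Matrix κ κ ℂ)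
    (ν : ℝ) {t : ℝ} (ht : t ∈ Set.Icc (0 : ℝ) 1) :
    HasMatDerivAt (fun u => logIntegrand A E u t) (logIntegrandDeriv A E ν t) ν := by
  have hd := (hasMatDerivAt_logSegment_fst A ν t).inv (isUnit_logSegment hA ν ht)
  refine ((hd.mul (HasMatDerivAt.const E ν)).mul hd).congr_deriv ?_
  simp only [logIntegrandDeriv, neg_smul, Matrix.mul_neg, Matrix.neg_mul, neg_neg,
    Matrix.mul_smul, Matrix.smul_mul, Matrix.mul_one, Matrix.mul_zero, add_zero, smul_add,
    Matrix.mul_assoc]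

/-- The `ν`-derivative of the integrand is an exact derivative in `t`. With `N = 1 + t D` one has `t
N⁻¹ D N⁻¹ = N⁻¹ - N⁻²`, so in the `t`-derivative of `j t² N⁻¹ E N⁻¹` the terms `2 j t N⁻¹ E N⁻¹`
cancel, leaving `j t (N⁻² E N⁻¹ + N⁻¹ E N⁻²)`. -/
theorem hasMatDerivAt_sq_smul_logIntegrand {A : Matrix κ κ ℝ} (hA : IsHurwitz A)
    (E : Matrix κ κ ℂ) (ν : ℝ) {t : ℝ} (ht : t ∈ Set.Icc (0 : ℝ) 1) :
    HasMatDerivAt (fun t : ℝ => (Complex.I * (t : ℂ) ^ 2) • logIntegrand A E ν t)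
      (logIntegrandDeriv A E ν t) t := by
  have hu := isUnit_logSegment hA ν ht
  have hd := (hasMatDerivAt_logSegment_snd A ν t).inv hu
  have hc : HasDerivAt (fun t : ℝ => Complex.I * (t : ℂ) ^ 2) (Complex.I * (2 * (t : ℂ))) t := by
    refine (((Complex.ofRealCLM.hasDerivAt (x := t)).pow 2).const_mul Complex.I).congr_deriv ?_
    simp
  refine (HasMatDerivAt.smul hc ((hd.mul (HasMatDerivAt.const E t)).mul hd)).congr_deriv ?_
  have hdet := (Matrix.isUnit_iff_isUnit_det _).1 hu
  rw [logIntegrandDeriv]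
  set D := (-(Complex.I * ν) • (1 : Matrix κ κ ℂ) - toC A) - 1 with hD
  have h1 : (t : ℂ) • D = logSegment A ν t - 1 := by
    rw [logSegment, add_sub_cancel_right]
  generalize logSegment A ν t = N at *
  have key : (t : ℂ) • (N⁻¹ * D * N⁻¹) = N⁻¹ - N⁻¹ * N⁻¹ := by
    rw [← Matrix.smul_mul, ← Matrix.mul_smul, h1, Matrix.mul_sub, Matrix.sub_mul,
      Matrix.nonsing_inv_mul _ hdet, Matrix.one_mul, Matrix.mul_one]
  have e1 : (Complex.I * (t : ℂ) ^ 2) • ((-(N⁻¹ * D * N⁻¹) * E + N⁻¹ * 0) * N⁻¹ +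
        N⁻¹ * E * -(N⁻¹ * D * N⁻¹)) =
      -(((t : ℂ) * Complex.I) • (((t : ℂ) • (N⁻¹ * D * N⁻¹)) * E * N⁻¹ +
        N⁻¹ * E * ((t : ℂ) • (N⁻¹ * D * N⁻¹)))) := by
    have e0 : Complex.I * (t : ℂ) ^ 2 = (t : ℂ) * Complex.I * (t : ℂ) := by ring
    rw [Matrix.mul_zero, add_zero, Matrix.neg_mul, Matrix.neg_mul, Matrix.mul_neg, ← neg_add,
      smul_neg, e0, mul_smul, smul_add (t : ℂ)]
    simp only [Matrix.smul_mul, Matrix.mul_smul]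
  rw [e1, key]
  have e2 : (Complex.I * (2 * (t : ℂ))) = ((t : ℂ) * Complex.I) * 2 := by ring
  rw [e2, mul_smul, ← smul_neg, ← smul_add, two_smul]
  congr 1
  simp only [Matrix.sub_mul, Matrix.mul_sub]
  abel

/-- After differentiation under the integral, the integral over `t` is evaluated by the primitive `j
t² N⁻¹ E N⁻¹`: it vanishes at `t = 0`, and at `t = 1` the matrix `N` is `-jν - A`. -/
theorem hasMatDerivAt_logFrechet {A : Matrix κ κ ℝ} (hA : IsHurwitz A) (E : Matrix κ κ ℂ)
    (ν : ℝ) :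
    HasMatDerivAt (fun u : ℝ => logFrechet (-(Complex.I * u) • (1 : Matrix κ κ ℂ) - toC A) E)
      (Complex.I • (res A (-(Complex.I * ν)) * E * res A (-(Complex.I * ν)))) ν := by
  have hI : Set.uIcc (0 : ℝ) 1 = Set.Icc 0 1 := Set.uIcc_of_le zero_le_one
  have hmem : ∀ t ∈ Set.uIcc (0 : ℝ) 1, t ∈ Set.Icc (0 : ℝ) 1 := fun t ht => by
    rwa [hI] at ht
  have hc : ∀ u, ContinuousOn (logIntegrand A E u) (Set.uIcc 0 1) := fun u => by
    rw [hI]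
    exact (continuousOn_logIntegrand hA E).uncurry_left u (Set.mem_univ u)
  have hc' : ∀ u, ContinuousOn (logIntegrandDeriv A E u) (Set.uIcc 0 1) := fun u => by
    rw [hI]
    exact (continuousOn_logIntegrandDeriv hA E).uncurry_left u (Set.mem_univ u)
  have hc'' : ContinuousOn (Function.uncurry (logIntegrandDeriv A E))
      (Metric.ball ν 1 ×ˢ Set.uIcc 0 1) := by
    rw [hI]
    exact (continuousOn_logIntegrandDeriv hA E).mono (Set.prod_mono (Set.subset_univ _) le_rfl)
  have hderiv : HasMatDerivAt (fun u => matIntegral 0 1 (logIntegrand A E u))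
      (matIntegral 0 1 (logIntegrandDeriv A E ν)) ν :=
    HasMatDerivAt.matIntegral one_pos
      (fun u _ t ht => hasMatDerivAt_logIntegrand hA E u (hmem t ht)) (fun u _ => hc u) hc''
  have hFTC : matIntegral 0 1 (logIntegrandDeriv A E ν) = _ - _ :=
    matIntegral_eq_sub_of_hasMatDerivAt
      (f := fun t : ℝ => (Complex.I * (t : ℂ) ^ 2) • logIntegrand A E ν t)
      (fun t ht => hasMatDerivAt_sq_smul_logIntegrand hA E ν (hmem t ht)) (hc' ν)
  refine HasMatDerivAt.congr_deriv (f' := matIntegral 0 1 (logIntegrandDeriv A E ν)) hderiv ?_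
  rw [hFTC]
  simp [logIntegrand, logSegment, res]

theorem logFrechet_eq_add_matIntegral {A : Matrix κ κ ℝ} (hA : IsHurwitz A) (E : Matrix κ κ ℂ)
    (ω : ℝ) :
    logFrechet (-(Complex.I * ω) • (1 : Matrix κ κ ℂ) - toC A) E = logFrechet (-toC A) E +
      Complex.I • matIntegral 0 ω
        (fun ν => res A (-(Complex.I * ν)) * E * res A (-(Complex.I * ν))) := by
  have hres : Continuous fun ν : ℝ => res A (-(Complex.I * ν)) := by
    have := (continuous_res hA).comp continuous_neg
    simpa [Function.comp_def] using this
  have hc : Continuous fun ν : ℝ => Complex.I •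
      (res A (-(Complex.I * ν)) * E * res A (-(Complex.I * ν))) :=
    Continuous.const_smul ((hres.matrix_mul continuous_const).matrix_mul hres) Complex.I
  have := matIntegral_eq_sub_of_hasMatDerivAt (a := 0) (b := ω)
    (fun ν _ => hasMatDerivAt_logFrechet hA E ν) hc.continuousOn
  rw [matIntegral_smul] at this
  rw [this]
  simp

theorem logFrechet_map_star {X E : Matrix κ κ ℂ} (hX : X.map star = X) (hE : E.map star = E) :
    (logFrechet X E).map star = logFrechet X E := by
  rw [logFrechet, ← matIntegral_map_star]
  refine matIntegral_congr fun t => ?_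
  simp only [map_star_mul, map_star_inv, map_star_add, map_star_sub, map_star_smul, hX, hE]
  simp

/-- `Re ((j/π) 𝓛(-jω - A, E)) = -(1/2π) ∫_{-ω}^{ω} (jν - A)⁻¹ E (jν - A)⁻¹ dν` for real `E`. -/
theorem re_logFrechet {A : Matrix κ κ ℝ} (hA : IsHurwitz A) {E : Matrix κ κ ℂ}
    (hE : E.map star = E) (ω : ℝ) :
    toC (((Complex.I / Real.pi) •
      logFrechet (-(Complex.I * ω) • (1 : Matrix κ κ ℂ) - toC A) E).map Complex.re) =
    -((1 / (2 * Real.pi : ℂ)) • matIntegral (-ω) ω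
      (fun ν => res A (Complex.I * ν) * E * res A (Complex.I * ν))) := by
  set g : ℝ → Matrix κ κ ℂ := fun ν => res A (Complex.I * ν) * E * res A (Complex.I * ν) with hg
  have hgc : Continuous g :=
    ((continuous_res hA).matrix_mul continuous_const).matrix_mul (continuous_res hA)
  have hstar : ∀ ν, (g ν).map star = g (-ν) := fun ν => by
    simp only [hg, map_star_mul, res_map_star, hE]
    simp
  -- The contribution of `ν = 0` is real, so after multiplication by `j/π` it is purely imaginary
  -- and drops out of the real part.
  have h0 : (logFrechet (-toC A) E).map star = logFrechet (-toC A) E :=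
    logFrechet_map_star (by rw [map_star_neg, toC_map_star]) hE
  have hneg : matIntegral 0 ω (fun ν => res A (-(Complex.I * ν)) * E * res A (-(Complex.I * ν))) =
      (matIntegral 0 ω g).map star := by
    rw [← matIntegral_map_star]
    refine matIntegral_congr fun ν => ?_
    rw [hstar]
    simp [hg]
  -- The two half-range integrals are conjugate, so the full integral is twice the real part of one
  -- of them; this turns `1/π` into `1/(2π)`.
  have hsplit : matIntegral (-ω) ω g = (matIntegral 0 ω g).map star + matIntegral 0 ω g := by
    rw [← matIntegral_map_star]
    ext i j
    simp only [Matrix.add_apply, matIntegral_apply]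
    rw [← intervalIntegral.integral_add_adjacent_intervals (b := 0)
      ((hgc.entry i j).intervalIntegrable _ _) ((hgc.entry i j).intervalIntegrable _ _)]
    congr 1
    have := intervalIntegral.integral_comp_neg (a := 0) (b := ω) (fun ν => g ν i j)
    rw [neg_zero] at this
    rw [← this]
    simp only [hstar]
  rw [logFrechet_eq_add_matIntegral hA, hneg, hsplit]
  ext i j
  have h0' := Complex.conj_eq_iff_im.1 (congrFun (congrFun h0 i) j)
  have hpi : (Real.pi : ℂ) ≠ 0 := by exact_mod_cast Real.pi_ne_zero
  simp only [toC_apply, Matrix.map_apply, Matrix.smul_apply, Matrix.add_apply, Matrix.neg_apply,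
    smul_eq_mul]
  generalize logFrechet (-toC A) E i j = z at h0'
  generalize matIntegral 0 ω g i j = w
  have e : Complex.I / (Real.pi : ℂ) * (z + Complex.I * star w) =
      ((Real.pi⁻¹ : ℝ) : ℂ) * (Complex.I * z - star w) := by
    push_cast
    field_simp
    ring_nf
    simp
    ring
  have e2 : (1 / (2 * Real.pi : ℂ)) * (star w + w) = ((Real.pi⁻¹ * w.re : ℝ) : ℂ) := by
    rw [add_comm]
    change 1 / (2 * (Real.pi : ℂ)) * (w + (starRingEnd ℂ) w) = _
    rw [Complex.add_conj]
    push_cast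
    field_simp
  rw [e, e2, Complex.re_ofReal_mul]
  simp [h0']

end LogFrechet

namespace LQOSystem

/-! ### The squared norm in terms of the Gramians -/

section Cost

variable {ι μ o : Type*} [Fintype ι] [DecidableEq ι] [Fintype μ] [Fintype o]

/-- The matrix `(jν - A)⁻¹ B`. -/
noncomputable def inputRes (S : LQOSystem ι μ o) (ν : ℝ) : Matrix ι μ ℂ :=
  res S.A (Complex.I * ν) * toC S.B

/-- The integrand of the controllability Gramian. -/
noncomputable def gramKernel (S : LQOSystem ι μ o) (ν : ℝ) : Matrix ι ι ℂ :=
  S.inputRes ν * (S.inputRes ν)ᴴ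

/-- The map `X ↦ ∑ M_i X M_i`. -/
noncomputable def quadMap (S : LQOSystem ι μ o) (X : Matrix ι ι ℂ) : Matrix ι ι ℂ :=
  ∑ i, toC (S.M i) * X * toC (S.M i)

/-- The matrix `Cᵀ C + 2 ∑ M_i P_ω M_i`. -/
noncomputable def weight (ω : ℝ) (S : LQOSystem ι μ o) : Matrix ι ι ℂ :=
  toC S.Cᵀ * toC S.C + 2 • S.quadMap (S.gramP ω)

/-- The sensitivity `(1/2π) ∫ (jν - A)⁻¹ B Bᵀ (jν - A)^{-*} (Cᵀ C + 2 ∑ M_i P_ω M_i) (jν - A)⁻¹ dν`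
of half the squared norm to the state matrix. -/
noncomputable def stateSens (ω : ℝ) (S : LQOSystem ι μ o) : Matrix ι ι ℂ :=
  (1 / (2 * Real.pi : ℂ)) • matIntegral (-ω) ω (fun ν =>
    S.gramKernel ν * S.weight ω * res S.A (Complex.I * ν))

theorem gramP_eq (ω : ℝ) (S : LQOSystem ι μ o) :
    S.gramP ω = (1 / (2 * Real.pi : ℂ)) • matIntegral (-ω) ω S.gramKernel := by
  rw [gramP]
  congr 1
  refine matIntegral_congr fun ν => ?_
  simp [gramKernel, inputRes, Matrix.conjTranspose_mul, Matrix.mul_assoc]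

theorem gramKernel_conjTranspose (S : LQOSystem ι μ o) (ν : ℝ) :
    (S.gramKernel ν)ᴴ = S.gramKernel ν := by
  simp [gramKernel, Matrix.conjTranspose_mul]

theorem star_one_div_two_pi : star (1 / (2 * Real.pi : ℂ)) = 1 / (2 * Real.pi : ℂ) := by
  simp

theorem gramP_conjTranspose (ω : ℝ) (S : LQOSystem ι μ o) : (S.gramP ω)ᴴ = S.gramP ω := by
  rw [gramP_eq, Matrix.conjTranspose_smul, star_one_div_two_pi, ← matIntegral_conjTranspose]
  simp only [gramKernel_conjTranspose]

theorem inputRes_map_star (S : LQOSystem ι μ o) (ν : ℝ) :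
    (S.inputRes ν).map star = S.inputRes (-ν) := by
  rw [inputRes, map_star_mul, res_map_star, toC_map_star, inputRes]
  simp

theorem gramKernel_map_star (S : LQOSystem ι μ o) (ν : ℝ) :
    (S.gramKernel ν).map star = S.gramKernel (-ν) := by
  rw [gramKernel, map_star_mul, map_star_conjTranspose, inputRes_map_star, gramKernel]

theorem gramP_map_star (ω : ℝ) (S : LQOSystem ι μ o) : (S.gramP ω).map star = S.gramP ω := by
  rw [gramP_eq, map_star_smul, star_one_div_two_pi,
    matIntegral_map_star_eq_self S.gramKernel_map_star]

theorem quadMap_map_star (S : LQOSystem ι μ o) {X : Matrix ι ι ℂ} (hX : X.map star = X) :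
    (S.quadMap X).map star = S.quadMap X := by
  simp only [quadMap, map_star_sum, map_star_mul, toC_map_star, hX]

theorem quadMap_conjTranspose {S : LQOSystem ι μ o} (hS : ∀ i, (S.M i).IsSymm)
    {X : Matrix ι ι ℂ} (hX : Xᴴ = X) : (S.quadMap X)ᴴ = S.quadMap X := by
  simp only [quadMap, Matrix.conjTranspose_sum, Matrix.conjTranspose_mul, toC_conjTranspose, hX,
    (hS _).eq, Matrix.mul_assoc]

theorem weight_map_star (ω : ℝ) (S : LQOSystem ι μ o) : (S.weight ω).map star = S.weight ω := by
  simp only [weight, map_star_add, two_smul, map_star_mul, toC_map_star,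
    quadMap_map_star S (S.gramP_map_star ω)]

theorem weight_conjTranspose (ω : ℝ) {S : LQOSystem ι μ o} (hS : ∀ i, (S.M i).IsSymm) :
    (S.weight ω)ᴴ = S.weight ω := by
  simp only [weight, two_smul, Matrix.conjTranspose_add, Matrix.conjTranspose_mul,
    toC_conjTranspose, quadMap_conjTranspose hS (S.gramP_conjTranspose ω), Matrix.transpose_transpose]

theorem continuous_inputRes {S : LQOSystem ι μ o} (hS : IsHurwitz S.A) :
    Continuous S.inputRes :=
  (continuous_res hS).matrix_mul continuous_const

theorem continuous_gramKernel {S : LQOSystem ι μ o} (hS : IsHurwitz S.A) :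
    Continuous S.gramKernel :=
  (continuous_inputRes hS).matrix_mul (continuous_inputRes hS).matrix_conjTranspose

/-- `Y_ω + 2 Z_ω` as one integral. -/
theorem gramY_add_two_smul_gramZ (ω : ℝ) {S : LQOSystem ι μ o} (hS : IsHurwitz S.A) :
    S.gramY ω + 2 • S.gramZ ω = (1 / (2 * Real.pi : ℂ)) • matIntegral (-ω) ω (fun ν =>
      (res S.A (Complex.I * ν))ᴴ * S.weight ω * res S.A (Complex.I * ν)) := by
  have hr := continuous_res hS
  have hc : ∀ N : Matrix ι ι ℂ, Continuous fun ν : ℝ =>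
      (res S.A (Complex.I * ν))ᴴ * N * res S.A (Complex.I * ν) := fun N =>
    (hr.matrix_conjTranspose.matrix_mul continuous_const).matrix_mul hr
  have h : ∀ ν : ℝ, (res S.A (Complex.I * ν))ᴴ * S.weight ω * res S.A (Complex.I * ν) =
      (res S.A (Complex.I * ν))ᴴ * (toC S.Cᵀ * toC S.C) * res S.A (Complex.I * ν) +
      (2 : ℂ) • ((res S.A (Complex.I * ν))ᴴ * S.quadMap (S.gramP ω) *
        res S.A (Complex.I * ν)) := fun ν => by
    rw [weight, Matrix.mul_add, Matrix.add_mul, two_smul, two_smul, Matrix.mul_add,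
      Matrix.add_mul]
  have hc2 : Continuous fun ν : ℝ => (2 : ℂ) • ((res S.A (Complex.I * ν))ᴴ *
      S.quadMap (S.gramP ω) * res S.A (Complex.I * ν)) := Continuous.const_smul (hc _) (2 : ℂ)
  rw [matIntegral_congr h, matIntegral_add (hc _) hc2,
    matIntegral_smul, smul_add, smul_comm _ (2 : ℂ)]
  simp only [gramY, gramZ, quadMap, Matrix.mul_assoc, two_smul]

/-- Self-adjointness of `X ↦ ∑ M_i X M_i` for the bilinear trace pairing, from cyclicity alone. It
factors the double integral and later produces the factor 2 in the weight. -/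
theorem trace_quadMap (S : LQOSystem ι μ o) (X Y : Matrix ι ι ℂ) :
    (X * S.quadMap Y).trace = (Y * S.quadMap X).trace := by
  simp only [quadMap, Matrix.mul_sum, Matrix.trace_sum]
  refine Finset.sum_congr rfl fun i _ => ?_
  rw [← Matrix.mul_assoc, Matrix.trace_mul_comm, ← Matrix.mul_assoc, ← Matrix.mul_assoc,
    ← Matrix.mul_assoc, Matrix.trace_mul_comm]
  simp only [Matrix.mul_assoc]

theorem quadMap_smul (S : LQOSystem ι μ o) (c : ℂ) (X : Matrix ι ι ℂ) :
    S.quadMap (c • X) = c • S.quadMap X := by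
  simp [quadMap, Finset.smul_sum]

theorem trace_G₁ (S : LQOSystem ι μ o) (ν : ℝ) :
    ((S.G₁ (Complex.I * ν))ᴴ * S.G₁ (Complex.I * ν)).trace =
      (S.gramKernel ν * (toC S.Cᵀ * toC S.C)).trace := by
  have h : S.G₁ (Complex.I * ν) = toC S.C * S.inputRes ν := by
    rw [G₁, inputRes, Matrix.mul_assoc]
  rw [h, Matrix.conjTranspose_mul, toC_conjTranspose, gramKernel,
    Matrix.mul_assoc (S.inputRes ν), Matrix.trace_mul_comm (S.inputRes ν)]
  simp only [Matrix.mul_assoc]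

/-- `G_{2,i}` is `x(ν₁)ᴴ M_i x(ν₂)` with `x` the matrix `inputRes`; with `M_i` symmetric, cyclicity
groups the factors into one kernel per frequency. -/
theorem trace_G₂ {S : LQOSystem ι μ o} (hS : ∀ i, (S.M i).IsSymm) (ν₁ ν₂ : ℝ) :
    (∑ i, (S.G₂ i (Complex.I * ν₁) (Complex.I * ν₂))ᴴ *
      S.G₂ i (Complex.I * ν₁) (Complex.I * ν₂)).trace =
      (S.gramKernel ν₂ * S.quadMap (S.gramKernel ν₁)).trace := by
  have h : ∀ i, S.G₂ i (Complex.I * ν₁) (Complex.I * ν₂) =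
      (S.inputRes ν₁)ᴴ * (toC (S.M i) * S.inputRes ν₂) := fun i => by
    simp only [G₂, inputRes, Matrix.conjTranspose_mul, toC_conjTranspose, Matrix.mul_assoc]
  simp only [quadMap, Matrix.mul_sum, Matrix.trace_sum]
  refine Finset.sum_congr rfl fun i _ => ?_
  rw [h, Matrix.conjTranspose_mul, Matrix.conjTranspose_mul, Matrix.conjTranspose_conjTranspose,
    toC_conjTranspose, (hS i).eq, gramKernel, gramKernel]
  rw [Matrix.mul_assoc (S.inputRes ν₂), Matrix.trace_mul_comm (S.inputRes ν₂)]
  simp only [Matrix.mul_assoc]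

/-- The integrand of the double integral is bilinear in the kernels at `ν₁` and `ν₂`, so each
integration replaces one kernel by its integral and absorbs one factor `1/(2π)`. -/
theorem trace_h2Norm (ω : ℝ) {S : LQOSystem ι μ o} (hS : S.IsAdmissible) :
    Matrix.trace (
    (1 / (2 * Real.pi : ℂ)) • matIntegral (-ω) ω (fun ν =>
        (S.G₁ (Complex.I * ν)).conjTranspose * S.G₁ (Complex.I * ν))
    + (1 / (2 * Real.pi : ℂ) ^ 2) • matIntegral (-ω) ω (fun ν₁ => matIntegral (-ω) ω (fun ν₂ =>
        ∑ i, (S.G₂ i (Complex.I * ν₁) (Complex.I * ν₂)).conjTranspose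
          * S.G₂ i (Complex.I * ν₁) (Complex.I * ν₂)))) =
    (S.gramP ω * (toC S.Cᵀ * toC S.C)).trace + (S.gramP ω * S.quadMap (S.gramP ω)).trace := by
  have hr := continuous_res hS.1
  have hX := continuous_gramKernel hS.1
  have hG₁ : Continuous fun ν : ℝ => S.G₁ (Complex.I * ν) :=
    (continuous_const.matrix_mul hr).matrix_mul continuous_const
  have hG₂ : ∀ i, Continuous fun q : ℝ × ℝ => S.G₂ i (Complex.I * q.1) (Complex.I * q.2) :=
    fun i => (((continuous_const.matrix_mul
      (hr.comp continuous_fst).matrix_conjTranspose).matrix_mul continuous_const).matrix_mul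
      (hr.comp continuous_snd)).matrix_mul continuous_const
  have hG₂r : ∀ i (ν₁ : ℝ), Continuous fun ν₂ : ℝ =>
      S.G₂ i (Complex.I * ν₁) (Complex.I * ν₂) :=
    fun i ν₁ => (continuous_const.matrix_mul hr).matrix_mul continuous_const
  have hsum : Continuous fun q : ℝ × ℝ =>
      ∑ i, (S.G₂ i (Complex.I * q.1) (Complex.I * q.2)).conjTranspose
          * S.G₂ i (Complex.I * q.1) (Complex.I * q.2) :=
    continuous_finsetSum _ fun i _ => (hG₂ i).matrix_conjTranspose.matrix_mul (hG₂ i)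
  have hinner : Continuous fun ν₁ : ℝ => matIntegral (-ω) ω (fun ν₂ =>
        ∑ i, (S.G₂ i (Complex.I * ν₁) (Complex.I * ν₂)).conjTranspose
          * S.G₂ i (Complex.I * ν₁) (Complex.I * ν₂)) := by
    refine continuous_pi fun a => continuous_pi fun b => ?_
    exact intervalIntegral.continuous_parametric_intervalIntegral_of_continuous'
      (hsum.entry a b) (-ω) ω
  have hq : Continuous fun ν => S.quadMap (S.gramKernel ν) :=
    continuous_finsetSum _ fun i _ =>
      (continuous_const.matrix_mul hX).matrix_mul continuous_const
  set I := matIntegral (-ω) ω S.gramKernel with hI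
  have h1 : (matIntegral (-ω) ω (fun ν =>
      (S.G₁ (Complex.I * ν)).conjTranspose * S.G₁ (Complex.I * ν))).trace =
      (I * (toC S.Cᵀ * toC S.C)).trace := by
    rw [trace_matIntegral (hG₁.matrix_conjTranspose.matrix_mul hG₁), ← matIntegral_mul_const _ hX,
      trace_matIntegral (hX.matrix_mul continuous_const)]
    simp only [trace_G₁]
  have h2 : ∀ ν₁ : ℝ, (matIntegral (-ω) ω (fun ν₂ =>
        ∑ i, (S.G₂ i (Complex.I * ν₁) (Complex.I * ν₂)).conjTranspose
          * S.G₂ i (Complex.I * ν₁) (Complex.I * ν₂))).trace =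
      (S.gramKernel ν₁ * S.quadMap I).trace := fun ν₁ => by
    have hs : Continuous fun ν₂ : ℝ =>
        ∑ i, (S.G₂ i (Complex.I * ν₁) (Complex.I * ν₂)).conjTranspose
          * S.G₂ i (Complex.I * ν₁) (Complex.I * ν₂) :=
      continuous_finsetSum _ fun i _ => (hG₂r i ν₁).matrix_conjTranspose.matrix_mul (hG₂r i ν₁)
    rw [trace_matIntegral hs, trace_quadMap, ← matIntegral_mul_const _ hX,
      trace_matIntegral (hX.matrix_mul continuous_const)]
    simp only [trace_G₂ hS.2]
  have h3 : (matIntegral (-ω) ω (fun ν₁ => matIntegral (-ω) ω (fun ν₂ =>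
        ∑ i, (S.G₂ i (Complex.I * ν₁) (Complex.I * ν₂)).conjTranspose
          * S.G₂ i (Complex.I * ν₁) (Complex.I * ν₂)))).trace = (I * S.quadMap I).trace := by
    rw [trace_matIntegral hinner, ← matIntegral_mul_const _ hX,
      trace_matIntegral (hX.matrix_mul continuous_const)]
    simp only [h2]
  rw [Matrix.trace_add, Matrix.trace_smul, Matrix.trace_smul, h1, h3, gramP_eq, quadMap_smul,
    Matrix.smul_mul, Matrix.smul_mul, Matrix.mul_smul, Matrix.trace_smul, Matrix.trace_smul,
    Matrix.trace_smul, smul_smul]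
  congr 2
  ring

open scoped ComplexOrder in
theorem matIntegral_diag_nonneg {κ : Type*} {a b : ℝ} (hab : a ≤ b) {f : ℝ → Matrix κ κ ℂ}
    (i : κ) (hf : ∀ ν, 0 ≤ f ν i i) : 0 ≤ matIntegral a b f i i := by
  have h : ∀ ν, f ν i i = ((f ν i i).re : ℂ) := fun ν =>
    (Complex.eq_re_of_ofReal_le (r := 0) (by simpa using hf ν))
  rw [matIntegral_apply, funext h, intervalIntegral.integral_ofReal]
  exact Complex.zero_le_real.2
    (intervalIntegral.integral_nonneg hab fun ν _ => (Complex.nonneg_iff.1 (hf ν)).1)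

open scoped ComplexOrder in
/-- The squared frequency-limited `H₂` norm. -/
theorem h2Norm_sq {ω : ℝ} (hω : 0 ≤ ω) {S : LQOSystem ι μ o} (hS : S.IsAdmissible) :
    S.h2Norm ω ^ 2 = ((S.gramP ω * (toC S.Cᵀ * toC S.C)).trace +
      (S.gramP ω * S.quadMap (S.gramP ω)).trace).re := by
  rw [← trace_h2Norm ω hS, h2Norm, Real.sq_sqrt]
  -- What remains is nonnegativity under the square root: the diagonal entries are integrals of
  -- diagonal entries of matrices `Fᴴ F`, or sums of such matrices.
  have hω' : -ω ≤ ω := by linarith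
  have hc : (0 : ℂ) ≤ 1 / (2 * Real.pi : ℂ) := by
    have h : (1 / (2 * Real.pi : ℂ)) = ((1 / (2 * Real.pi) : ℝ) : ℂ) := by push_cast; rfl
    rw [h]
    exact Complex.zero_le_real.2 (by positivity)
  have hc2 : (0 : ℂ) ≤ 1 / (2 * Real.pi : ℂ) ^ 2 := by
    have h : (1 / (2 * Real.pi : ℂ) ^ 2) = ((1 / (2 * Real.pi) ^ 2 : ℝ) : ℂ) := by push_cast; rfl
    rw [h]
    exact Complex.zero_le_real.2 (by positivity)
  refine (Complex.nonneg_iff.1 (Finset.sum_nonneg fun j _ => ?_)).1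
  simp only [Matrix.diag_apply, Matrix.add_apply, Matrix.smul_apply, smul_eq_mul]
  refine add_nonneg (mul_nonneg hc (matIntegral_diag_nonneg hω' j fun ν => ?_))
    (mul_nonneg hc2 (matIntegral_diag_nonneg hω' j fun ν₁ =>
      matIntegral_diag_nonneg hω' j fun ν₂ => ?_))
  · exact (Matrix.posSemidef_conjTranspose_mul_self _).diag_nonneg
  · rw [Matrix.sum_apply]
    exact Finset.sum_nonneg fun i _ =>
      (Matrix.posSemidef_conjTranspose_mul_self _).diag_nonneg

end Cost

end LQOSystem

namespace LQOSystem

/-! ### The derivative of the squared norm along a line of systems -/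

section Derivative

variable {ι μ o : Type*} [Fintype ι] [DecidableEq ι] [Fintype μ] [Fintype o]

theorem hasMatDerivAt_toC_add_smul {ι κ : Type*} (X H : Matrix ι κ ℝ) (t : ℝ) :
    HasMatDerivAt (fun u : ℝ => toC (X + u • H)) (toC H) t := by
  intro i j
  have h := ((Complex.ofRealCLM.hasDerivAt (x := t)).mul_const (H i j : ℂ)).const_add (X i j : ℂ)
  simpa using h

theorem continuous_toC_add_smul {ι κ : Type*} (X H : Matrix ι κ ℝ) :
    Continuous fun t : ℝ => toC (X + t • H) := by
  simp only [toC_add, toC_smul]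
  fun_prop

/-- The derivative of `inputRes` along the direction `H`. -/
noncomputable def inputResDeriv (S H : LQOSystem ι μ o) (ν : ℝ) : Matrix ι μ ℂ :=
  res S.A (Complex.I * ν) * toC H.A * S.inputRes ν + res S.A (Complex.I * ν) * toC H.B

theorem hasMatDerivAt_res {A H : Matrix ι ι ℝ} {t : ℝ} (hA : IsHurwitz (A + t • H)) {s : ℂ}
    (hs : 0 ≤ s.re) :
    HasMatDerivAt (fun u : ℝ => res (A + u • H) s)
      (res (A + t • H) s * toC H * res (A + t • H) s) t := by
  have h : HasMatDerivAt (fun u : ℝ => s • (1 : Matrix ι ι ℂ) - toC (A + u • H)) (-toC H) t :=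
    fun i j => ((hasMatDerivAt_toC_add_smul A H t) i j).const_sub _
  refine (h.inv (isHurwitz_iff_isUnit.1 hA s hs)).congr_deriv ?_
  rw [Matrix.mul_neg, Matrix.neg_mul, neg_neg, res]

theorem hasMatDerivAt_inputRes {S H : LQOSystem ι μ o} {t : ℝ} (hA : IsHurwitz (S + t • H).A)
    (ν : ℝ) :
    HasMatDerivAt (fun u : ℝ => (S + u • H).inputRes ν) (inputResDeriv (S + t • H) H ν) t := by
  refine ((hasMatDerivAt_res (A := S.A) (H := H.A) hA (by simp)).mul
    (hasMatDerivAt_toC_add_smul S.B H.B t)).congr_deriv ?_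
  rw [inputResDeriv, Matrix.mul_assoc (_ * _)]
  rfl

theorem continuousOn_res_add_smul {A H : Matrix ι ι ℝ} {U : Set ℝ}
    (hU : ∀ t ∈ U, IsHurwitz (A + t • H)) (T : Set ℝ) :
    ContinuousOn (fun q : ℝ × ℝ => res (A + q.1 • H) (Complex.I * q.2)) (U ×ˢ T) := by
  refine ContinuousOn.matrixInv (Continuous.continuousOn ?_) fun q hq =>
    isHurwitz_iff_isUnit.1 (hU q.1 hq.1) _ (by simp)
  have := (continuous_toC_add_smul A H).comp (continuous_fst (X := ℝ) (Y := ℝ))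
  exact Continuous.sub (by fun_prop) this

/-- The derivative of the controllability Gramian. -/
theorem hasMatDerivAt_gramP (ω : ℝ) {S : LQOSystem ι μ o} (hS : IsHurwitz S.A)
    (H : LQOSystem ι μ o) :
    HasMatDerivAt (fun t : ℝ => (S + t • H).gramP ω)
      ((1 / (2 * Real.pi : ℂ)) • matIntegral (-ω) ω (fun ν =>
        S.inputResDeriv H ν * (S.inputRes ν)ᴴ + S.inputRes ν * (S.inputResDeriv H ν)ᴴ)) 0 := by
  -- Differentiation under the integral needs a whole interval of `t` on which the resolvents exist
  -- for all frequencies.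
  obtain ⟨ε, hε, hball⟩ := Metric.eventually_nhds_iff_ball.1 (hS.eventually H.A)
  have hA : ∀ t ∈ Metric.ball (0 : ℝ) ε, IsHurwitz (S + t • H).A := hball
  have hr := continuousOn_res_add_smul hball (Set.uIcc (-ω) ω)
  have hB : ContinuousOn (fun q : ℝ × ℝ => toC (S.B + q.1 • H.B))
      (Metric.ball 0 ε ×ˢ Set.uIcc (-ω) ω) :=
    ((continuous_toC_add_smul S.B H.B).comp continuous_fst).continuousOn
  have hi : ContinuousOn (fun q : ℝ × ℝ => (S + q.1 • H).inputRes q.2)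
      (Metric.ball 0 ε ×ˢ Set.uIcc (-ω) ω) := hr.matrixMul hB
  have hd : ContinuousOn (fun q : ℝ × ℝ => (S + q.1 • H).inputResDeriv H q.2)
      (Metric.ball 0 ε ×ˢ Set.uIcc (-ω) ω) :=
    ((hr.matrixMul continuousOn_const).matrixMul hi).add (hr.matrixMul continuousOn_const)
  have hstar : ∀ {f : ℝ × ℝ → Matrix ι μ ℂ} {s : Set (ℝ × ℝ)}, ContinuousOn f s →
      ContinuousOn (fun q => (f q)ᴴ) s := fun hf => by
    rw [continuousOn_iff_continuous_domRestrict] at *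
    exact hf.matrix_conjTranspose
  have hmain := HasMatDerivAt.matIntegral (t := 0) (a := -ω) (b := ω) hε
    (F := fun t ν => (S + t • H).gramKernel ν)
    (F' := fun t ν => (S + t • H).inputResDeriv H ν * ((S + t • H).inputRes ν)ᴴ +
      (S + t • H).inputRes ν * ((S + t • H).inputResDeriv H ν)ᴴ)
    (fun t ht ν _ => (hasMatDerivAt_inputRes (hA t ht) ν).mul
      (hasMatDerivAt_inputRes (hA t ht) ν).conjTranspose)
    (fun t ht => (continuous_gramKernel (hA t ht)).continuousOn)
    ((hd.matrixMul (hstar hi)).add (hi.matrixMul (hstar hd)))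
  have h0 : S + (0 : ℝ) • H = S := by rw [zero_smul, add_zero]
  simp only [h0] at hmain
  simp only [gramP_eq]
  exact hmain.const_smul _

theorem re_trace_conjTranspose (X : Matrix ι ι ℂ) : Xᴴ.trace.re = X.trace.re := by
  rw [Matrix.trace_conjTranspose]
  exact Complex.conj_re _

theorem continuous_inputResDeriv {S : LQOSystem ι μ o} (hS : IsHurwitz S.A)
    (H : LQOSystem ι μ o) : Continuous (S.inputResDeriv H) :=
  (((continuous_res hS).matrix_mul continuous_const).matrix_mul (continuous_inputRes hS)).add
    ((continuous_res hS).matrix_mul continuous_const)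

/-- Lifts a trace identity with constant factors from each frequency to the integrals. -/
theorem trace_smul_matIntegral_mul {c : ℂ} {a b : ℝ} {X Y : ℝ → Matrix ι ι ℂ}
    {D E : Matrix ι ι ℂ} {l : Type*} [Fintype l] {T : ℝ → Matrix l ι ℂ} {K : Matrix ι l ℂ}
    (hX : Continuous X) (hY : Continuous Y) (hT : Continuous T)
    (h : ∀ ν, (X ν * D).trace = (E * Y ν).trace + (K * T ν).trace) :
    ((c • matIntegral a b X) * D).trace =
      (E * (c • matIntegral a b Y)).trace + (K * (c • matIntegral a b T)).trace := by
  rw [Matrix.smul_mul, Matrix.mul_smul, Matrix.mul_smul, Matrix.trace_smul, Matrix.trace_smul,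
    Matrix.trace_smul, ← matIntegral_mul_const _ hX, ← matIntegral_const_mul _ hY,
    ← matIntegral_const_mul _ hT, trace_matIntegral (hX.matrix_mul continuous_const),
    trace_matIntegral (continuous_const.matrix_mul hY),
    trace_matIntegral (continuous_const.matrix_mul hT), ← smul_add]
  rw [← intervalIntegral.integral_add
    ((continuous_const.matrix_mul hY).matrix_trace.intervalIntegrable _ _)
    ((continuous_const.matrix_mul hT).matrix_trace.intervalIntegrable _ _)]
  simp only [h]

/-- The pairing of the derivative of the Gramian with the weight. -/
theorem re_trace_gramP_deriv_mul_weight (ω : ℝ) {S : LQOSystem ι μ o} (hS : S.IsAdmissible)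
    (H : LQOSystem ι μ o) :
    (((1 / (2 * Real.pi : ℂ)) • matIntegral (-ω) ω (fun ν =>
        S.inputResDeriv H ν * (S.inputRes ν)ᴴ + S.inputRes ν * (S.inputResDeriv H ν)ᴴ)) *
        S.weight ω).trace.re =
      2 * ((toC H.A * S.stateSens ω).trace +
        (toC H.B * (toC S.Bᵀ * (S.gramY ω + 2 • S.gramZ ω))).trace).re := by
  have hr := continuous_res hS.1
  have hi := continuous_inputRes hS.1
  have hd := continuous_inputResDeriv hS.1 H
  have hQ : Continuous fun ν => S.inputResDeriv H ν * (S.inputRes ν)ᴴ :=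
    hd.matrix_mul hi.matrix_conjTranspose
  set Q := matIntegral (-ω) ω (fun ν => S.inputResDeriv H ν * (S.inputRes ν)ᴴ) with hQdef
  -- The two terms of the product rule are adjoint to each other and the weight is Hermitian, so
  -- they have the same real trace; hence the factor 2.
  have h1 : matIntegral (-ω) ω (fun ν =>
        S.inputResDeriv H ν * (S.inputRes ν)ᴴ + S.inputRes ν * (S.inputResDeriv H ν)ᴴ) =
      Q + Qᴴ := by
    rw [matIntegral_add hQ (hi.matrix_mul hd.matrix_conjTranspose), hQdef,
      ← matIntegral_conjTranspose]
    simp only [Matrix.conjTranspose_mul, Matrix.conjTranspose_conjTranspose]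
  set c : ℂ := 1 / (2 * Real.pi : ℂ) with hc
  have h2 : ((c • Qᴴ) * S.weight ω).trace.re = ((c • Q) * S.weight ω).trace.re := by
    have h := re_trace_conjTranspose ((c • Q) * S.weight ω)
    rw [← h, Matrix.conjTranspose_mul, weight_conjTranspose ω hS.2, Matrix.conjTranspose_smul,
      star_one_div_two_pi, Matrix.trace_mul_comm]
  have hstar : toC S.Bᵀ * (S.gramY ω + 2 • S.gramZ ω) = c • matIntegral (-ω) ω (fun ν =>
      (S.inputRes ν)ᴴ * S.weight ω * res S.A (Complex.I * ν)) := by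
    rw [gramY_add_two_smul_gramZ ω hS.1, Matrix.mul_smul, ← matIntegral_const_mul _
      ((hr.matrix_conjTranspose.matrix_mul continuous_const).matrix_mul hr)]
    simp only [hc, inputRes, Matrix.conjTranspose_mul, toC_conjTranspose, Matrix.mul_assoc]
  rw [h1, smul_add, Matrix.add_mul, Matrix.trace_add, Complex.add_re, h2, ← two_mul, hstar,
    stateSens, ← hc]
  congr 2
  refine trace_smul_matIntegral_mul (Y := fun ν => S.gramKernel ν * S.weight ω *
    res S.A (Complex.I * ν)) hQ
    (((continuous_gramKernel hS.1).matrix_mul continuous_const).matrix_mul hr)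
    ((hi.matrix_conjTranspose.matrix_mul continuous_const).matrix_mul hr) fun ν => ?_
  rw [inputResDeriv, gramKernel, Matrix.add_mul, Matrix.add_mul, Matrix.trace_add]
  congr 1
  · simp only [Matrix.mul_assoc]
    rw [Matrix.trace_mul_comm]
    simp only [Matrix.mul_assoc]
  · simp only [Matrix.mul_assoc]
    rw [Matrix.trace_mul_comm]
    simp only [Matrix.mul_assoc]

/-- The derivative of the squared frequency-limited `H₂` norm in the direction `H`. -/
theorem hasDerivAt_h2Norm_sq {ω : ℝ} (hω : 0 ≤ ω) {S : LQOSystem ι μ o} (hS : S.IsAdmissible)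
    {H : LQOSystem ι μ o} (hH : ∀ i, (H.M i).IsSymm) :
    HasDerivAt (fun t : ℝ => (S + t • H).h2Norm ω ^ 2)
      (2 * ((toC H.A * S.stateSens ω).trace +
        (toC H.B * (toC S.Bᵀ * (S.gramY ω + 2 • S.gramZ ω))).trace +
        (toC H.C * (S.gramP ω * toC S.Cᵀ)).trace +
        ∑ i, (toC (H.M i) * (S.gramP ω * toC (S.M i) * S.gramP ω)).trace).re) 0 := by
  have hsymm : ∀ (t : ℝ) i, ((S + t • H).M i).IsSymm := fun t i =>
    (hS.2 i).add ((hH i).smul t)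
  -- The trace formula is available only for admissible systems, which suffices near `t = 0`.
  have hev : (fun t : ℝ => (S + t • H).h2Norm ω ^ 2) =ᶠ[nhds 0] fun t : ℝ =>
      (((S + t • H).gramP ω * (toC (S + t • H).Cᵀ * toC (S + t • H).C)).trace +
      ((S + t • H).gramP ω * (S + t • H).quadMap ((S + t • H).gramP ω)).trace).re := by
    filter_upwards [hS.1.eventually H.A] with t ht
    exact h2Norm_sq hω ⟨ht, hsymm t⟩
  refine HasDerivAt.congr_of_eventuallyEq ?_ hev
  have h0 : S + (0 : ℝ) • H = S := by rw [zero_smul, add_zero]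
  set P := S.gramP ω with hP
  set D := (1 / (2 * Real.pi : ℂ)) • matIntegral (-ω) ω (fun ν =>
        S.inputResDeriv H ν * (S.inputRes ν)ᴴ + S.inputRes ν * (S.inputResDeriv H ν)ᴴ) with hD
  have hdP : HasMatDerivAt (fun t : ℝ => (S + t • H).gramP ω) D 0 := hasMatDerivAt_gramP ω hS.1 H
  have hdC : HasMatDerivAt (fun t : ℝ => toC (S + t • H).C) (toC H.C) 0 :=
    hasMatDerivAt_toC_add_smul S.C H.C 0
  have hdCT : HasMatDerivAt (fun t : ℝ => toC (S + t • H).Cᵀ) (toC H.Cᵀ) 0 :=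
    fun i j => hdC j i
  have hdM : ∀ i, HasMatDerivAt (fun t : ℝ => toC ((S + t • H).M i)) (toC (H.M i)) 0 :=
    fun i => hasMatDerivAt_toC_add_smul (S.M i) (H.M i) 0
  have hquad : HasMatDerivAt (fun t : ℝ => (S + t • H).quadMap ((S + t • H).gramP ω))
      (∑ i, ((toC (H.M i) * P + toC (S.M i) * D) * toC (S.M i) +
        toC (S.M i) * P * toC (H.M i))) 0 := by
    have := HasMatDerivAt.finset_sum Finset.univ
      (fun i _ => ((hdM i).mul hdP).mul (hdM i))
    simp only [h0] at this
    exact this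
  have hcost := ((hdP.mul (hdCT.mul hdC)).trace).add ((hdP.mul hquad).trace)
  simp only [h0] at hcost
  have hre := Complex.reCLM.hasFDerivAt.comp_hasDerivAt (0 : ℝ) hcost
  refine HasDerivAt.congr_deriv (f' := _) hre ?_
  rw [Complex.reCLM_apply]
  have hPs : Pᴴ = P := S.gramP_conjTranspose ω
  have hw : (D * S.weight ω).trace =
      (D * (toC S.Cᵀ * toC S.C)).trace + 2 * (D * S.quadMap P).trace := by
    rw [weight, Matrix.mul_add, two_smul, Matrix.mul_add, Matrix.trace_add, Matrix.trace_add,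
      ← two_mul]
  have hDre := re_trace_gramP_deriv_mul_weight ω hS H
  rw [← hD, hw] at hDre
  have hC1 : (P * (toC H.Cᵀ * toC S.C)).trace.re = (toC H.C * (P * toC S.Cᵀ)).trace.re := by
    rw [← re_trace_conjTranspose, Matrix.conjTranspose_mul, Matrix.conjTranspose_mul,
      toC_conjTranspose, toC_conjTranspose, hPs, Matrix.transpose_transpose,
      Matrix.mul_assoc, Matrix.trace_mul_comm, Matrix.mul_assoc]
  have hC2 : (P * (toC S.Cᵀ * toC H.C)).trace = (toC H.C * (P * toC S.Cᵀ)).trace := by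
    rw [← Matrix.mul_assoc, Matrix.trace_mul_comm]
  -- The derivative `D` of the inner Gramian is moved outside by `trace_quadMap`, where it joins the
  -- one from the outer factor; together they give the second summand of the weight.
  have hM : (P * ∑ i, ((toC (H.M i) * P + toC (S.M i) * D) * toC (S.M i) +
        toC (S.M i) * P * toC (H.M i))).trace =
      2 * ∑ i, (toC (H.M i) * (P * toC (S.M i) * P)).trace + (D * S.quadMap P).trace := by
    rw [trace_quadMap, quadMap, Matrix.mul_sum, Matrix.mul_sum, Matrix.trace_sum,
      Matrix.trace_sum, Finset.mul_sum, ← Finset.sum_add_distrib]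
    refine Finset.sum_congr rfl fun i _ => ?_
    rw [Matrix.add_mul, Matrix.mul_add, Matrix.mul_add, Matrix.trace_add, Matrix.trace_add]
    have e1 : (P * (toC (H.M i) * P * toC (S.M i))).trace =
        (toC (H.M i) * (P * toC (S.M i) * P)).trace := by
      rw [Matrix.trace_mul_comm]
      simp only [Matrix.mul_assoc]
    have e2 : (P * (toC (S.M i) * P * toC (H.M i))).trace =
        (toC (H.M i) * (P * toC (S.M i) * P)).trace := by
      rw [← Matrix.mul_assoc, Matrix.trace_mul_comm]
      simp only [Matrix.mul_assoc]
    rw [e1, e2]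
    ring
  rw [Matrix.mul_add, Matrix.trace_add, Matrix.trace_add, Matrix.trace_add, hM, hC2]
  simp only [Complex.add_re, Complex.mul_re, Complex.re_ofNat, Complex.im_ofNat, zero_mul,
    sub_zero] at hDre ⊢
  rw [hC1]
  linarith

end Derivative

end LQOSystem

/-! ### Blocks -/

section Blocks

variable {ι κ l : Type*} [Fintype ι] [Fintype κ]

theorem toC_fromBlocks {a b c d : Type*} (A : Matrix a b ℝ) (B : Matrix a d ℝ) (C : Matrix c b ℝ)
    (D : Matrix c d ℝ) : toC (Matrix.fromBlocks A B C D) =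
      Matrix.fromBlocks (toC A) (toC B) (toC C) (toC D) :=
  Matrix.fromBlocks_map _ _ _ _ _

theorem trace_fromBlocks (A : Matrix ι ι ℂ) (B : Matrix ι κ ℂ) (C : Matrix κ ι ℂ)
    (D : Matrix κ κ ℂ) : (Matrix.fromBlocks A B C D).trace = A.trace + D.trace := by
  simp [Matrix.trace]

theorem toBlocks₁₂_diag_mul_mul_diag (X : Matrix (ι ⊕ κ) (ι ⊕ κ) ℂ) (A A' : Matrix ι ι ℂ)
    (D D' : Matrix κ κ ℂ) :
    (Matrix.fromBlocks A 0 0 D * X * Matrix.fromBlocks A' 0 0 D').toBlocks₁₂ =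
      A * X.toBlocks₁₂ * D' := by
  conv_lhs => rw [← Matrix.fromBlocks_toBlocks X]
  simp [Matrix.fromBlocks_multiply]

theorem toBlocks₂₂_diag_mul_mul_diag (X : Matrix (ι ⊕ κ) (ι ⊕ κ) ℂ) (A A' : Matrix ι ι ℂ)
    (D D' : Matrix κ κ ℂ) :
    (Matrix.fromBlocks A 0 0 D * X * Matrix.fromBlocks A' 0 0 D').toBlocks₂₂ =
      D * X.toBlocks₂₂ * D' := by
  conv_lhs => rw [← Matrix.fromBlocks_toBlocks X]
  simp [Matrix.fromBlocks_multiply]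

theorem toBlocks₂₂_mul (X Y : Matrix (ι ⊕ κ) (ι ⊕ κ) ℂ) :
    (X * Y).toBlocks₂₂ = X.toBlocks₂₁ * Y.toBlocks₁₂ + X.toBlocks₂₂ * Y.toBlocks₂₂ := by
  conv_lhs => rw [← Matrix.fromBlocks_toBlocks X, ← Matrix.fromBlocks_toBlocks Y]
  simp [Matrix.fromBlocks_multiply]

theorem toBlocks₁₂_sum {α : Type*} (s : Finset α) (X : α → Matrix (ι ⊕ κ) (ι ⊕ κ) ℂ) :
    (∑ q ∈ s, X q).toBlocks₁₂ = ∑ q ∈ s, (X q).toBlocks₁₂ := by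
  ext
  simp [Matrix.toBlocks₁₂, Matrix.sum_apply]

theorem toBlocks₂₂_sum {α : Type*} (s : Finset α) (X : α → Matrix (ι ⊕ κ) (ι ⊕ κ) ℂ) :
    (∑ q ∈ s, X q).toBlocks₂₂ = ∑ q ∈ s, (X q).toBlocks₂₂ := by
  ext
  simp [Matrix.toBlocks₂₂, Matrix.sum_apply]

open scoped ComplexOrder in
/-- A real matrix `X` with `trace (Xᵀ X) = 0` vanishes. -/
theorem eq_zero_of_re_trace {X : Matrix ι κ ℂ} (hX : X.map star = X)
    (h : (toC (X.map Complex.re)ᵀ * X).trace.re = 0) : X = 0 := by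
  rw [toC_transpose, eq_toC_of_map_star hX, ← conjTranspose_eq_transpose_of_map_star hX] at h
  have h2 := (Matrix.posSemidef_conjTranspose_mul_self X).trace_nonneg
  refine Matrix.trace_conjTranspose_mul_self_eq_zero_iff.1 (Complex.ext h ?_)
  exact (Complex.nonneg_iff.1 h2).2.symm

end Blocks

/-! ### Lyapunov and Sylvester equations on the imaginary axis -/

section ImaginaryAxis

variable {ι κ : Type*} [Fintype ι] [DecidableEq ι] [Fintype κ] [DecidableEq κ]

/-- If `A X + X Bᵀ + D = 0` then `(s - A)⁻¹ D (s - B)^{-*} = X (s - B)^{-*} + (s - A)⁻¹ X` for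
imaginary `s`. -/
theorem res_mul_mul_res_conjTranspose {A : Matrix ι ι ℝ} {B : Matrix κ κ ℝ} (hA : IsHurwitz A)
    (hB : IsHurwitz B) {X D : Matrix ι κ ℂ} (h : toC A * X + X * toC Bᵀ + D = 0) (ν : ℝ) :
    res A (Complex.I * ν) * D * (res B (Complex.I * ν))ᴴ =
      X * (res B (Complex.I * ν))ᴴ + res A (Complex.I * ν) * X := by
  have hs : 0 ≤ (Complex.I * ν : ℂ).re := by simp
  -- On the imaginary axis `s + star s = 0`, so the shifts by `s` cancel and the Sylvester equation
  -- expresses `D` through the two shifted matrices.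
  have hD : D = ((Complex.I * ν) • (1 : Matrix ι ι ℂ) - toC A) * X +
      X * ((Complex.I * ν) • (1 : Matrix κ κ ℂ) - toC B)ᴴ := by
    rw [← sub_eq_zero, ← h]
    simp [Matrix.sub_mul, Matrix.mul_sub]
    abel
  have h2 : ((Complex.I * ν) • (1 : Matrix κ κ ℂ) - toC B)ᴴ * (res B (Complex.I * ν))ᴴ = 1 := by
    rw [← Matrix.conjTranspose_mul, res_mul hB hs, Matrix.conjTranspose_one]
  rw [hD, Matrix.mul_add, Matrix.add_mul, ← Matrix.mul_assoc, res_mul hA hs, Matrix.one_mul,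
    Matrix.mul_assoc, Matrix.mul_assoc X, h2, Matrix.mul_one]

/-- If `Aᵀ X + X B + D = 0` then `(s - A)^{-*} D (s - B)⁻¹ = X (s - B)⁻¹ + (s - A)^{-*} X` for
imaginary `s`. -/
theorem res_conjTranspose_mul_mul_res {A : Matrix ι ι ℝ} {B : Matrix κ κ ℝ} (hA : IsHurwitz A)
    (hB : IsHurwitz B) {X D : Matrix ι κ ℂ} (h : toC Aᵀ * X + X * toC B + D = 0) (ν : ℝ) :
    (res A (Complex.I * ν))ᴴ * D * res B (Complex.I * ν) =
      X * res B (Complex.I * ν) + (res A (Complex.I * ν))ᴴ * X := by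
  have hs : 0 ≤ (Complex.I * ν : ℂ).re := by simp
  have hD : D = ((Complex.I * ν) • (1 : Matrix ι ι ℂ) - toC A)ᴴ * X +
      X * ((Complex.I * ν) • (1 : Matrix κ κ ℂ) - toC B) := by
    rw [← sub_eq_zero, ← h]
    simp [Matrix.sub_mul, Matrix.mul_sub]
    abel
  have h2 : (res A (Complex.I * ν))ᴴ * ((Complex.I * ν) • (1 : Matrix ι ι ℂ) - toC A)ᴴ = 1 := by
    rw [← Matrix.conjTranspose_mul, mul_res hA hs, Matrix.conjTranspose_one]
  rw [hD, Matrix.mul_add, Matrix.add_mul, ← Matrix.mul_assoc, h2, Matrix.one_mul,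
    Matrix.mul_assoc, Matrix.mul_assoc X, mul_res hB hs, Matrix.mul_one]

/-- The adjoint of the solution solves the adjoint equation, whose solution is unique. This yields
Hermitian symmetry of `P_k` and `Z̄_k`. -/
theorem sylvesterSol_conjTranspose {A : Matrix ι ι ℝ} {B : Matrix κ κ ℝ} (hA : IsHurwitz A)
    (hB : IsHurwitz B) (D : Matrix ι κ ℂ) :
    (sylvesterSol (toC A) (toC B) D)ᴴ = sylvesterSol (toC Bᵀ) (toC Aᵀ) Dᴴ := by
  refine (existsUnique_sylvester hB.transpose hA.transpose Dᴴ).unique ?_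
    (sylvesterSol_spec hB.transpose hA.transpose Dᴴ)
  have h := congrArg Matrix.conjTranspose (sylvesterSol_spec hA hB D)
  simp only [Matrix.conjTranspose_add, Matrix.conjTranspose_mul, toC_conjTranspose,
    Matrix.conjTranspose_zero] at h
  rwa [add_comm (toC Bᵀ * _)]

end ImaginaryAxis

namespace LQOSystem

/-! ### Blocks of the error system -/

section ErrorSystem

variable {ι κ μ o : Type*} [Fintype ι] [DecidableEq ι] [Fintype κ] [DecidableEq κ] [Fintype μ]
  [Fintype o]

theorem isAdmissible_err {G : LQOSystem ι μ o} {R : LQOSystem κ μ o} (hG : G.IsAdmissible)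
    (hR : R.IsAdmissible) : (G.err R).IsAdmissible :=
  ⟨isHurwitz_fromBlocks hG.1 hR.1, fun i =>
    (hG.2 i).fromBlocks (by simp) (show (-R.M i)ᵀ = -R.M i by rw [Matrix.transpose_neg, (hR.2 i).eq])⟩

/-- The error realization is affine in the reduced system, so lines of reduced systems become lines
of error systems, whose direction has zero full-order blocks. -/
theorem err_add_smul (G : LQOSystem ι μ o) (R H : LQOSystem κ μ o) (t : ℝ) :
    G.err (R + t • H) = G.err R + t • (0 : LQOSystem ι μ o).err H := by
  refine Prod.ext ?_ (Prod.ext ?_ (Prod.ext ?_ (funext fun q => ?_)))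
  · ext (i | i) (j | j) <;> simp [err, A]
  · ext (i | i) j <;> simp [err, B]
  · ext i (j | j) <;> simp [err, C]
    ring
  · ext (i | i) (j | j) <;> simp [err, M]
    ring

variable (ω : ℝ) (G : LQOSystem ι μ o) (R : LQOSystem κ μ o)

theorem P₁₂ω_conjTranspose : (G.P₁₂ω ω R)ᴴ = ((G.err R).gramP ω).toBlocks₂₁ := by
  conv_rhs => rw [← gramP_conjTranspose]
  rfl

theorem Pₖω_conjTranspose : (G.Pₖω ω R)ᴴ = G.Pₖω ω R := by
  conv_rhs => rw [Pₖω, ← gramP_conjTranspose]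
  rfl

theorem gramP_err : (G.err R).gramP ω = Matrix.fromBlocks ((G.err R).gramP ω).toBlocks₁₁
    (G.P₁₂ω ω R) (G.P₁₂ω ω R)ᴴ (G.Pₖω ω R) := by
  conv_lhs => rw [← Matrix.fromBlocks_toBlocks ((G.err R).gramP ω)]
  rw [P₁₂ω_conjTranspose]
  rfl

theorem P₁₂ω_map_star : (G.P₁₂ω ω R).map star = G.P₁₂ω ω R := by
  conv_rhs => rw [P₁₂ω, ← gramP_map_star]
  rfl

theorem Pₖω_map_star : (G.Pₖω ω R).map star = G.Pₖω ω R := by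
  conv_rhs => rw [Pₖω, ← gramP_map_star]
  rfl

theorem inputRes_err {G : LQOSystem ι μ o} {R : LQOSystem κ μ o} (hG : IsHurwitz G.A)
    (hR : IsHurwitz R.A) (ν : ℝ) :
    (G.err R).inputRes ν = Matrix.fromRows (G.inputRes ν) (R.inputRes ν) := by
  have hB : toC (G.err R).B = Matrix.fromRows (toC G.B) (toC R.B) := by
    ext (i | i) j <;> rfl
  have hA : (G.err R).A = Matrix.fromBlocks G.A 0 0 R.A := rfl
  rw [inputRes, hB, hA, res_fromBlocks hG hR (by simp), Matrix.fromBlocks_mul_fromRows]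
  simp [inputRes]

theorem gramKernel_err {G : LQOSystem ι μ o} {R : LQOSystem κ μ o} (hG : IsHurwitz G.A)
    (hR : IsHurwitz R.A) (ν : ℝ) :
    (G.err R).gramKernel ν = Matrix.fromBlocks (G.gramKernel ν) (G.inputRes ν * (R.inputRes ν)ᴴ)
      (R.inputRes ν * (G.inputRes ν)ᴴ) (R.gramKernel ν) := by
  rw [gramKernel, inputRes_err hG hR, Matrix.conjTranspose_fromRows_eq_fromCols_conjTranspose,
    Matrix.fromRows_mul_fromCols]
  rfl

/-- The matrix `∑ M_i P_{12,ω} M_{k,i}`. -/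
noncomputable def quad₁₂ : Matrix ι κ ℂ := ∑ i, toC (G.M i) * G.P₁₂ω ω R * toC (R.M i)

/-- The matrix `∑ M_{k,i} P_{k,ω} M_{k,i}`. -/
noncomputable def quadₖ : Matrix κ κ ℂ := ∑ i, toC (R.M i) * G.Pₖω ω R * toC (R.M i)

theorem toC_M_err (i : o) :
    toC ((G.err R).M i) = Matrix.fromBlocks (toC (G.M i)) 0 0 (-toC (R.M i)) := by
  change toC (Matrix.fromBlocks (G.M i) 0 0 (-R.M i)) = _
  rw [toC_fromBlocks, toC_zero, toC_zero, toC_neg]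

theorem quadMap_err_toBlocks₁₂ :
    ((G.err R).quadMap ((G.err R).gramP ω)).toBlocks₁₂ = -G.quad₁₂ ω R := by
  simp only [quadMap, toBlocks₁₂_sum, toC_M_err, toBlocks₁₂_diag_mul_mul_diag, quad₁₂, P₁₂ω,
    Matrix.mul_neg, Finset.sum_neg_distrib]

theorem quadMap_err_toBlocks₂₂ :
    ((G.err R).quadMap ((G.err R).gramP ω)).toBlocks₂₂ = G.quadₖ ω R := by
  simp only [quadMap, toBlocks₂₂_sum, toC_M_err, toBlocks₂₂_diag_mul_mul_diag, quadₖ, Pₖω,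
    Matrix.mul_neg, Matrix.neg_mul, neg_neg]

theorem toC_C_err : toC (G.err R).C = Matrix.fromCols (toC G.C) (-toC R.C) := by
  ext i (j | j) <;> simp [err, C]

theorem toC_C_err_transpose :
    toC (G.err R).Cᵀ = Matrix.fromRows (toC G.Cᵀ) (-toC R.Cᵀ) := by
  ext (i | i) j <;> simp [err, C]

theorem toC_B_err_transpose :
    toC (G.err R).Bᵀ = Matrix.fromCols (toC G.Bᵀ) (toC R.Bᵀ) := by
  ext i (j | j) <;> simp [err, B]

theorem outputGram_err : toC (G.err R).Cᵀ * toC (G.err R).C =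
    Matrix.fromBlocks (toC G.Cᵀ * toC G.C) (-(toC G.Cᵀ * toC R.C))
      (-(toC R.Cᵀ * toC G.C)) (toC R.Cᵀ * toC R.C) := by
  rw [toC_C_err, toC_C_err_transpose, Matrix.fromRows_mul_fromCols]
  simp

/-! ### Blocks of the weight, the Gramians and the state sensitivity -/

theorem weight_err_toBlocks₁₂ : ((G.err R).weight ω).toBlocks₁₂ =
    -(toC G.Cᵀ * toC R.C + 2 • G.quad₁₂ ω R) := by
  have h : ((G.err R).weight ω).toBlocks₁₂ = (toC (G.err R).Cᵀ * toC (G.err R).C).toBlocks₁₂ +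
      2 • ((G.err R).quadMap ((G.err R).gramP ω)).toBlocks₁₂ := by
    rw [weight, two_smul, two_smul]
    rfl
  rw [h, outputGram_err, quadMap_err_toBlocks₁₂, Matrix.toBlocks_fromBlocks₁₂, smul_neg, neg_add]

theorem weight_err_toBlocks₂₂ : ((G.err R).weight ω).toBlocks₂₂ =
    toC R.Cᵀ * toC R.C + 2 • G.quadₖ ω R := by
  have h : ((G.err R).weight ω).toBlocks₂₂ = (toC (G.err R).Cᵀ * toC (G.err R).C).toBlocks₂₂ +
      2 • ((G.err R).quadMap ((G.err R).gramP ω)).toBlocks₂₂ := by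
    rw [weight, two_smul, two_smul]
    rfl
  rw [h, outputGram_err, quadMap_err_toBlocks₂₂, Matrix.toBlocks_fromBlocks₂₂]

theorem P₁₂ω_conjTranspose_eq {G : LQOSystem ι μ o} {R : LQOSystem κ μ o} (hG : IsHurwitz G.A)
    (hR : IsHurwitz R.A) : (G.P₁₂ω ω R)ᴴ = (1 / (2 * Real.pi : ℂ)) •
      matIntegral (-ω) ω (fun ν => R.inputRes ν * (G.inputRes ν)ᴴ) := by
  rw [P₁₂ω_conjTranspose, gramP_eq, funext (gramKernel_err hG hR)]
  rfl

theorem Pₖω_eq {G : LQOSystem ι μ o} {R : LQOSystem κ μ o} (hG : IsHurwitz G.A)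
    (hR : IsHurwitz R.A) : G.Pₖω ω R = (1 / (2 * Real.pi : ℂ)) •
      matIntegral (-ω) ω R.gramKernel := by
  rw [Pₖω, gramP_eq, funext (gramKernel_err hG hR)]
  rfl

theorem res_err {G : LQOSystem ι μ o} {R : LQOSystem κ μ o} (hG : IsHurwitz G.A)
    (hR : IsHurwitz R.A) (ν : ℝ) : res (G.err R).A (Complex.I * ν) =
      Matrix.fromBlocks (res G.A (Complex.I * ν)) 0 0 (res R.A (Complex.I * ν)) :=
  res_fromBlocks hG hR (by simp)

theorem res_err_conjTranspose {G : LQOSystem ι μ o} {R : LQOSystem κ μ o} (hG : IsHurwitz G.A)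
    (hR : IsHurwitz R.A) (ν : ℝ) : (res (G.err R).A (Complex.I * ν))ᴴ =
      Matrix.fromBlocks (res G.A (Complex.I * ν))ᴴ 0 0 (res R.A (Complex.I * ν))ᴴ := by
  rw [res_err hG hR, Matrix.fromBlocks_conjTranspose]
  simp

theorem Y₁₂ω_eq {G : LQOSystem ι μ o} {R : LQOSystem κ μ o} (hG : IsHurwitz G.A)
    (hR : IsHurwitz R.A) : G.Y₁₂ω ω R = (1 / (2 * Real.pi : ℂ)) • matIntegral (-ω) ω (fun ν =>
      (res G.A (Complex.I * ν))ᴴ * (toC G.Cᵀ * toC R.C) * res R.A (Complex.I * ν)) := by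
  have h : ∀ ν : ℝ, (-((res (G.err R).A (Complex.I * ν))ᴴ * toC (G.err R).Cᵀ * toC (G.err R).C *
      res (G.err R).A (Complex.I * ν))).toBlocks₁₂ =
      (res G.A (Complex.I * ν))ᴴ * (toC G.Cᵀ * toC R.C) * res R.A (Complex.I * ν) := fun ν => by
    rw [Matrix.mul_assoc _ (toC (G.err R).Cᵀ), res_err_conjTranspose hG hR, res_err hG hR]
    change -(_ * _ * _ : Matrix (ι ⊕ κ) (ι ⊕ κ) ℂ).toBlocks₁₂ = _
    rw [toBlocks₁₂_diag_mul_mul_diag, outputGram_err, Matrix.toBlocks_fromBlocks₁₂, Matrix.mul_neg,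
      Matrix.neg_mul, neg_neg]
  rw [← funext h, Y₁₂ω, gramY]
  change -((1 / (2 * Real.pi : ℂ)) • (matIntegral (-ω) ω _).toBlocks₁₂) = _
  rw [← smul_neg]
  congr 1
  exact (congrArg Matrix.toBlocks₁₂ (matIntegral_neg _)).symm

theorem Yₖω_eq {G : LQOSystem ι μ o} {R : LQOSystem κ μ o} (hG : IsHurwitz G.A)
    (hR : IsHurwitz R.A) : G.Yₖω ω R = (1 / (2 * Real.pi : ℂ)) • matIntegral (-ω) ω (fun ν =>
      (res R.A (Complex.I * ν))ᴴ * (toC R.Cᵀ * toC R.C) * res R.A (Complex.I * ν)) := by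
  have h : ∀ ν : ℝ, ((res (G.err R).A (Complex.I * ν))ᴴ * toC (G.err R).Cᵀ * toC (G.err R).C *
      res (G.err R).A (Complex.I * ν)).toBlocks₂₂ =
      (res R.A (Complex.I * ν))ᴴ * (toC R.Cᵀ * toC R.C) * res R.A (Complex.I * ν) := fun ν => by
    rw [Matrix.mul_assoc _ (toC (G.err R).Cᵀ), res_err_conjTranspose hG hR, res_err hG hR,
      toBlocks₂₂_diag_mul_mul_diag, outputGram_err, Matrix.toBlocks_fromBlocks₂₂]
  rw [← funext h, Yₖω, gramY]
  rfl

theorem Z₁₂ω_eq {G : LQOSystem ι μ o} {R : LQOSystem κ μ o} (hG : IsHurwitz G.A)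
    (hR : IsHurwitz R.A) : G.Z₁₂ω ω R = (1 / (2 * Real.pi : ℂ)) • matIntegral (-ω) ω (fun ν =>
      (res G.A (Complex.I * ν))ᴴ * G.quad₁₂ ω R * res R.A (Complex.I * ν)) := by
  have h : ∀ ν : ℝ, (-((res (G.err R).A (Complex.I * ν))ᴴ *
      (G.err R).quadMap ((G.err R).gramP ω) * res (G.err R).A (Complex.I * ν))).toBlocks₁₂ =
      (res G.A (Complex.I * ν))ᴴ * G.quad₁₂ ω R * res R.A (Complex.I * ν) := fun ν => by
    rw [res_err_conjTranspose hG hR, res_err hG hR]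
    change -(_ * _ * _ : Matrix (ι ⊕ κ) (ι ⊕ κ) ℂ).toBlocks₁₂ = _
    rw [toBlocks₁₂_diag_mul_mul_diag, quadMap_err_toBlocks₁₂, Matrix.mul_neg,
      Matrix.neg_mul, neg_neg]
  rw [← funext h, Z₁₂ω, gramZ]
  change -((1 / (2 * Real.pi : ℂ)) • (matIntegral (-ω) ω _).toBlocks₁₂) = _
  rw [← smul_neg]
  congr 1
  exact (congrArg Matrix.toBlocks₁₂ (matIntegral_neg _)).symm

theorem Zₖω_eq {G : LQOSystem ι μ o} {R : LQOSystem κ μ o} (hG : IsHurwitz G.A)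
    (hR : IsHurwitz R.A) : G.Zₖω ω R = (1 / (2 * Real.pi : ℂ)) • matIntegral (-ω) ω (fun ν =>
      (res R.A (Complex.I * ν))ᴴ * G.quadₖ ω R * res R.A (Complex.I * ν)) := by
  have h : ∀ ν : ℝ, ((res (G.err R).A (Complex.I * ν))ᴴ *
      (G.err R).quadMap ((G.err R).gramP ω) * res (G.err R).A (Complex.I * ν)).toBlocks₂₂ =
      (res R.A (Complex.I * ν))ᴴ * G.quadₖ ω R * res R.A (Complex.I * ν) := fun ν => by
    rw [res_err_conjTranspose hG hR, res_err hG hR,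
      toBlocks₂₂_diag_mul_mul_diag, quadMap_err_toBlocks₂₂]
  rw [← funext h, Zₖω, gramZ]
  rfl

theorem stateSens_err_toBlocks₂₂ {G : LQOSystem ι μ o} {R : LQOSystem κ μ o} (hG : IsHurwitz G.A)
    (hR : IsHurwitz R.A) : ((G.err R).stateSens ω).toBlocks₂₂ =
      (1 / (2 * Real.pi : ℂ)) • matIntegral (-ω) ω (fun ν =>
        (-(R.inputRes ν * (G.inputRes ν)ᴴ * (toC G.Cᵀ * toC R.C + 2 • G.quad₁₂ ω R)) +
          R.gramKernel ν * (toC R.Cᵀ * toC R.C + 2 • G.quadₖ ω R)) * res R.A (Complex.I * ν)) := by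
  have h : ∀ ν : ℝ, ((G.err R).gramKernel ν * (G.err R).weight ω *
      res (G.err R).A (Complex.I * ν)).toBlocks₂₂ =
      (-(R.inputRes ν * (G.inputRes ν)ᴴ * (toC G.Cᵀ * toC R.C + 2 • G.quad₁₂ ω R)) +
          R.gramKernel ν * (toC R.Cᵀ * toC R.C + 2 • G.quadₖ ω R)) * res R.A (Complex.I * ν) :=
    fun ν => by
    rw [toBlocks₂₂_mul, res_err hG hR, Matrix.toBlocks_fromBlocks₁₂,
      Matrix.toBlocks_fromBlocks₂₂, Matrix.mul_zero, zero_add, toBlocks₂₂_mul,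
      weight_err_toBlocks₁₂, weight_err_toBlocks₂₂, gramKernel_err hG hR,
      Matrix.toBlocks_fromBlocks₂₁, Matrix.toBlocks_fromBlocks₂₂, Matrix.mul_neg]
  rw [← funext h, stateSens]
  rfl

end ErrorSystem

end LQOSystem

namespace LQOSystem

/-! ### The gradient with respect to the reduced state matrix -/

section Gradient

variable {ι κ μ o : Type*} [Fintype ι] [DecidableEq ι] [Fintype κ] [DecidableEq κ] [Fintype μ]
  [Fintype o]
variable (ω : ℝ) {G : LQOSystem ι μ o} {R : LQOSystem κ μ o}

theorem P₁₂_map_star (hG : IsHurwitz G.A) (hR : IsHurwitz R.A) :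
    (G.P₁₂ R).map star = G.P₁₂ R :=
  sylvesterSol_map_star hG hR.transpose (by rw [map_star_mul, toC_map_star, toC_map_star])

theorem Pₖ_map_star (hR : IsHurwitz R.A) : R.Pₖ.map star = R.Pₖ :=
  sylvesterSol_map_star hR hR.transpose (by rw [map_star_mul, toC_map_star, toC_map_star])

theorem quad₁₂_map_star : (G.quad₁₂ ω R).map star = G.quad₁₂ ω R := by
  simp only [quad₁₂, map_star_sum, map_star_mul, toC_map_star, P₁₂ω_map_star]

theorem quadₖ_map_star : (G.quadₖ ω R).map star = G.quadₖ ω R := by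
  simp only [quadₖ, map_star_sum, map_star_mul, toC_map_star, Pₖω_map_star]

theorem Zbar₁₂_map_star (hG : IsHurwitz G.A) (hR : IsHurwitz R.A) :
    (G.Zbar₁₂ ω R).map star = G.Zbar₁₂ ω R :=
  sylvesterSol_map_star hG.transpose hR (quad₁₂_map_star ω)

theorem Zbarₖ_map_star (hR : IsHurwitz R.A) : (G.Zbarₖ ω R).map star = G.Zbarₖ ω R :=
  sylvesterSol_map_star hR.transpose hR (quadₖ_map_star ω)

theorem V_eq : G.V ω R = toC R.B * toC G.Bᵀ * G.Zbar₁₂ ω R - toC R.B * toC R.Bᵀ * G.Zbarₖ ω R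
    + (G.P₁₂ R)ᵀ * toC G.Cᵀ * toC R.C - R.Pₖ * toC R.Cᵀ * toC R.C
    + (G.P₁₂ R)ᵀ * G.quad₁₂ ω R - R.Pₖ * G.quadₖ ω R := rfl

theorem V_map_star (hG : IsHurwitz G.A) (hR : IsHurwitz R.A) :
    (G.V ω R).map star = G.V ω R := by
  have hT : (G.P₁₂ R)ᵀ.map star = (G.P₁₂ R)ᵀ := congrArg Matrix.transpose (P₁₂_map_star hG hR)
  simp only [V_eq, map_star_add, map_star_sub, map_star_mul, toC_map_star, hT, Pₖ_map_star hR,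
    quad₁₂_map_star, quadₖ_map_star, Zbar₁₂_map_star ω hG hR, Zbarₖ_map_star ω hR]

theorem W_eq (hG : IsHurwitz G.A) (hR : IsHurwitz R.A) :
    G.W ω R = (1 / (2 * Real.pi : ℂ)) • matIntegral (-ω) ω (fun ν =>
      -(res R.A (Complex.I * ν) * G.V ω R * res R.A (Complex.I * ν))) := by
  rw [matIntegral_neg, smul_neg]
  exact re_logFrechet hR (V_map_star ω hG hR) ω

/-- The pointwise form of `stateSens_err_toBlocks₂₂_eq`. -/
theorem stateSens_integrand (hG : IsHurwitz G.A) (hR : IsHurwitz R.A) (ν : ℝ) :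
    (-(R.inputRes ν * (G.inputRes ν)ᴴ * (toC G.Cᵀ * toC R.C + 2 • G.quad₁₂ ω R)) +
        R.gramKernel ν * (toC R.Cᵀ * toC R.C + 2 • G.quadₖ ω R)) * res R.A (Complex.I * ν) =
      -(G.P₁₂ R)ᵀ * ((res G.A (Complex.I * ν))ᴴ * (toC G.Cᵀ * toC R.C) * res R.A (Complex.I * ν) +
        (res G.A (Complex.I * ν))ᴴ * G.quad₁₂ ω R * res R.A (Complex.I * ν)) +
      R.Pₖ * ((res R.A (Complex.I * ν))ᴴ * (toC R.Cᵀ * toC R.C) * res R.A (Complex.I * ν) +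
        (res R.A (Complex.I * ν))ᴴ * G.quadₖ ω R * res R.A (Complex.I * ν)) +
      R.inputRes ν * (G.inputRes ν)ᴴ * -G.Zbar₁₂ ω R + R.gramKernel ν * G.Zbarₖ ω R +
      -(res R.A (Complex.I * ν) * G.V ω R * res R.A (Complex.I * ν)) := by
  -- The lower-left kernel block has the reduced resolvent on the left, so the transposed equation
  -- for `P₁₂` is the one needed.
  have hP₁₂ : toC R.A * (G.P₁₂ R)ᵀ + (G.P₁₂ R)ᵀ * toC G.Aᵀ + toC R.B * toC G.Bᵀ = 0 := by
    have h := congrArg Matrix.transpose (sylvesterSol_spec hG hR.transpose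
      (toC G.B * toC R.Bᵀ))
    simp only [Matrix.transpose_add, Matrix.transpose_mul, Matrix.transpose_zero,
      ← toC_transpose, Matrix.transpose_transpose] at h
    rw [add_comm (_ * toC G.Aᵀ)] at h
    exact h
  have hPₖ : toC R.A * R.Pₖ + R.Pₖ * toC R.Aᵀ + toC R.B * toC R.Bᵀ = 0 :=
    sylvesterSol_spec hR hR.transpose _
  have hZ₁₂ : toC G.Aᵀ * G.Zbar₁₂ ω R + G.Zbar₁₂ ω R * toC R.A + G.quad₁₂ ω R = 0 :=
    sylvesterSol_spec hG.transpose hR _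
  have hZₖ : toC R.Aᵀ * G.Zbarₖ ω R + G.Zbarₖ ω R * toC R.A + G.quadₖ ω R = 0 :=
    sylvesterSol_spec hR.transpose hR _
  have ha := res_mul_mul_res_conjTranspose hR hG hP₁₂ ν
  have hb := res_mul_mul_res_conjTranspose hR hR hPₖ ν
  have hc := res_conjTranspose_mul_mul_res hG hR hZ₁₂ ν
  have hd := res_conjTranspose_mul_mul_res hR hR hZₖ ν
  have hX : R.inputRes ν * (G.inputRes ν)ᴴ =
      res R.A (Complex.I * ν) * (toC R.B * toC G.Bᵀ) * (res G.A (Complex.I * ν))ᴴ := by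
    simp only [inputRes, Matrix.conjTranspose_mul, toC_conjTranspose, Matrix.mul_assoc]
  have hK : R.gramKernel ν =
      res R.A (Complex.I * ν) * (toC R.B * toC R.Bᵀ) * (res R.A (Complex.I * ν))ᴴ := by
    simp only [gramKernel, inputRes, Matrix.conjTranspose_mul, toC_conjTranspose,
      Matrix.mul_assoc]
  rw [V_eq, Matrix.mul_assoc (G.P₁₂ R)ᵀ, Matrix.mul_assoc R.Pₖ]
  generalize R.inputRes ν * (G.inputRes ν)ᴴ = X at *
  generalize R.gramKernel ν = K at *
  generalize res R.A (Complex.I * ν) = r at *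
  generalize (res G.A (Complex.I * ν))ᴴ = g at *
  generalize toC G.Cᵀ * toC R.C = E₁ at *
  generalize toC R.Cᵀ * toC R.C = E₂ at *
  generalize toC R.B * toC G.Bᵀ = D₁ at *
  generalize toC R.B * toC R.Bᵀ = D₂ at *
  generalize G.quad₁₂ ω R = N₁ at *
  generalize G.quadₖ ω R = N₂ at *
  -- Observability side: the equation for `Z̄₁₂` splits `g N₁ r`. The first term belongs to the
  -- remainder `r V r`; the second integrates to `P_{12,ω}ᴴ Z̄₁₂`.
  have e1 : X * N₁ * r = r * D₁ * G.Zbar₁₂ ω R * r + X * G.Zbar₁₂ ω R := by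
    rw [hX, Matrix.mul_assoc _ g, Matrix.mul_assoc _ (g * N₁), hc, Matrix.mul_add]
    simp only [Matrix.mul_assoc]
  have e2 : K * N₂ * r = r * D₂ * G.Zbarₖ ω R * r + K * G.Zbarₖ ω R := by
    rw [hK, Matrix.mul_assoc _ rᴴ, Matrix.mul_assoc _ (rᴴ * N₂), hd, Matrix.mul_add]
    simp only [Matrix.mul_assoc]
  -- Controllability side: the equation for `P₁₂` splits `X` itself, leaving the integrands of
  -- `Y_{12,ω}` and `Z_{12,ω}` and another part of `r V r`.
  have e3 : X * (E₁ + N₁) * r = (G.P₁₂ R)ᵀ * (g * E₁ * r + g * N₁ * r) +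
      r * (G.P₁₂ R)ᵀ * (E₁ + N₁) * r := by
    rw [hX, ha]
    simp only [Matrix.add_mul, Matrix.mul_add, Matrix.mul_assoc]
    abel
  have e4 : K * (E₂ + N₂) * r = R.Pₖ * (rᴴ * E₂ * r + rᴴ * N₂ * r) +
      r * R.Pₖ * (E₂ + N₂) * r := by
    rw [hK, hb]
    simp only [Matrix.add_mul, Matrix.mul_add, Matrix.mul_assoc]
    abel
  -- The two copies of the quadratic term are treated differently: one stays with the linear output
  -- term and uses `P₁₂`, `P_k`; the other uses `Z̄₁₂`, `Z̄_k`.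
  have e5 : (-(X * (E₁ + 2 • N₁)) + K * (E₂ + 2 • N₂)) * r =
      -(X * (E₁ + N₁) * r) - X * N₁ * r + K * (E₂ + N₂) * r + K * N₂ * r := by
    simp only [two_smul, Matrix.add_mul, Matrix.mul_add, Matrix.neg_mul]
    abel
  rw [e5, e1, e2, e3, e4]
  simp only [Matrix.add_mul, Matrix.mul_add, Matrix.sub_mul, Matrix.mul_sub, Matrix.mul_assoc,
    Matrix.neg_mul, Matrix.mul_neg]
  abel

/-- The sensitivity of the squared error norm to the reduced state matrix. -/
theorem stateSens_err_toBlocks₂₂_eq (hG : IsHurwitz G.A) (hR : IsHurwitz R.A) :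
    ((G.err R).stateSens ω).toBlocks₂₂ =
      -(G.P₁₂ R)ᵀ * G.Q₁₂ω ω R + R.Pₖ * G.Qₖω ω R + (G.P₁₂ω ω R)ᴴ * -G.Zbar₁₂ ω R +
        G.Pₖω ω R * G.Zbarₖ ω R + G.W ω R := by
  have hg := continuous_res hG
  have hr := continuous_res hR
  have hi := continuous_inputRes hG
  have hj := continuous_inputRes hR
  have hK := continuous_gramKernel hR
  have c1 : ∀ E : Matrix ι κ ℂ, Continuous fun ν : ℝ =>
      (res G.A (Complex.I * ν))ᴴ * E * res R.A (Complex.I * ν) := fun E =>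
    (hg.matrix_conjTranspose.matrix_mul continuous_const).matrix_mul hr
  have c2 : ∀ E : Matrix κ κ ℂ, Continuous fun ν : ℝ =>
      (res R.A (Complex.I * ν))ᴴ * E * res R.A (Complex.I * ν) := fun E =>
    (hr.matrix_conjTranspose.matrix_mul continuous_const).matrix_mul hr
  have c3 : Continuous fun ν : ℝ => R.inputRes ν * (G.inputRes ν)ᴴ :=
    hj.matrix_mul hi.matrix_conjTranspose
  have c5 : Continuous fun ν : ℝ =>
      -(res R.A (Complex.I * ν) * G.V ω R * res R.A (Complex.I * ν)) :=
    ((hr.matrix_mul continuous_const).matrix_mul hr).neg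
  have d1 : ∀ E F : Matrix ι κ ℂ, Continuous fun ν : ℝ =>
      (res G.A (Complex.I * ν))ᴴ * E * res R.A (Complex.I * ν) +
        (res G.A (Complex.I * ν))ᴴ * F * res R.A (Complex.I * ν) := fun E F => (c1 E).add (c1 F)
  have d2 : ∀ E F : Matrix κ κ ℂ, Continuous fun ν : ℝ =>
      (res R.A (Complex.I * ν))ᴴ * E * res R.A (Complex.I * ν) +
        (res R.A (Complex.I * ν))ᴴ * F * res R.A (Complex.I * ν) := fun E F => (c2 E).add (c2 F)
  have f1 : Continuous fun ν : ℝ => -(G.P₁₂ R)ᵀ *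
      ((res G.A (Complex.I * ν))ᴴ * (toC G.Cᵀ * toC R.C) * res R.A (Complex.I * ν) +
        (res G.A (Complex.I * ν))ᴴ * G.quad₁₂ ω R * res R.A (Complex.I * ν)) :=
    continuous_const.matrix_mul (d1 _ _)
  have f2 : Continuous fun ν : ℝ => R.Pₖ *
      ((res R.A (Complex.I * ν))ᴴ * (toC R.Cᵀ * toC R.C) * res R.A (Complex.I * ν) +
        (res R.A (Complex.I * ν))ᴴ * G.quadₖ ω R * res R.A (Complex.I * ν)) :=
    continuous_const.matrix_mul (d2 _ _)
  have f3 : Continuous fun ν : ℝ => R.inputRes ν * (G.inputRes ν)ᴴ * -G.Zbar₁₂ ω R :=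
    c3.matrix_mul continuous_const
  have f4 : Continuous fun ν : ℝ => R.gramKernel ν * G.Zbarₖ ω R :=
    hK.matrix_mul continuous_const
  rw [stateSens_err_toBlocks₂₂ ω hG hR, matIntegral_congr (stateSens_integrand ω hG hR),
    matIntegral_add₅ f1 f2 f3 f4 c5, matIntegral_const_mul _ (d1 _ _),
    matIntegral_const_mul _ (d2 _ _), matIntegral_mul_const _ c3, matIntegral_mul_const _ hK,
    matIntegral_add (c1 _) (c1 _), matIntegral_add (c2 _) (c2 _), P₁₂ω_conjTranspose_eq ω hG hR,
    Pₖω_eq ω hG hR, Q₁₂ω, Qₖω, Y₁₂ω_eq ω hG hR, Z₁₂ω_eq ω hG hR, Yₖω_eq ω hG hR,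
    Zₖω_eq ω hG hR, W_eq ω hG hR]
  simp only [Matrix.mul_add, smul_add, Matrix.mul_smul, Matrix.smul_mul]

/-! ### Hermitian symmetry and reality of the matrices in the gradient -/

theorem Pₖ_conjTranspose (hR : IsHurwitz R.A) : R.Pₖᴴ = R.Pₖ := by
  rw [Pₖ, sylvesterSol_conjTranspose hR hR.transpose]
  simp [Matrix.conjTranspose_mul]

theorem quadₖ_conjTranspose (hR : ∀ i, (R.M i).IsSymm) :
    (G.quadₖ ω R)ᴴ = G.quadₖ ω R := by
  simp only [quadₖ, Matrix.conjTranspose_sum, Matrix.conjTranspose_mul, toC_conjTranspose,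
    Pₖω_conjTranspose, (hR _).eq, Matrix.mul_assoc]

theorem Zbarₖ_conjTranspose (hR : R.IsAdmissible) : (G.Zbarₖ ω R)ᴴ = G.Zbarₖ ω R := by
  rw [Zbarₖ, sylvesterSol_conjTranspose hR.1.transpose hR.1, Matrix.transpose_transpose]
  exact congrArg (sylvesterSol (toC R.Aᵀ) (toC R.A)) (quadₖ_conjTranspose ω hR.2)

theorem gramY_conjTranspose (S : LQOSystem ι μ o) : (S.gramY ω)ᴴ = S.gramY ω := by
  rw [gramY, Matrix.conjTranspose_smul, star_one_div_two_pi, ← matIntegral_conjTranspose]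
  simp only [Matrix.conjTranspose_mul, Matrix.conjTranspose_conjTranspose, toC_conjTranspose,
    Matrix.transpose_transpose, Matrix.mul_assoc]

theorem gramZ_conjTranspose {S : LQOSystem ι μ o} (hS : ∀ i, (S.M i).IsSymm) :
    (S.gramZ ω)ᴴ = S.gramZ ω := by
  have h := quadMap_conjTranspose hS (S.gramP_conjTranspose ω)
  have hZ : S.gramZ ω = (1 / (2 * Real.pi : ℂ)) • matIntegral (-ω) ω (fun ν =>
      (res S.A (Complex.I * ν))ᴴ * S.quadMap (S.gramP ω) * res S.A (Complex.I * ν)) := rfl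
  rw [hZ, Matrix.conjTranspose_smul, star_one_div_two_pi, ← matIntegral_conjTranspose]
  simp only [Matrix.conjTranspose_mul, Matrix.conjTranspose_conjTranspose, h, Matrix.mul_assoc]

theorem gramY_map_star (S : LQOSystem ι μ o) : (S.gramY ω).map star = S.gramY ω := by
  rw [gramY, map_star_smul, star_one_div_two_pi, matIntegral_map_star_eq_self fun ν => ?_]
  simp only [map_star_mul, map_star_conjTranspose, res_map_star, toC_map_star]
  simp

theorem gramZ_map_star (S : LQOSystem ι μ o) : (S.gramZ ω).map star = S.gramZ ω := by
  have h := quadMap_map_star S (S.gramP_map_star ω)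
  rw [quadMap] at h
  rw [gramZ, map_star_smul, star_one_div_two_pi, matIntegral_map_star_eq_self fun ν => ?_]
  simp only [map_star_mul, map_star_conjTranspose, res_map_star, h]
  simp

theorem stateSens_map_star (S : LQOSystem ι μ o) : (S.stateSens ω).map star = S.stateSens ω := by
  rw [stateSens, map_star_smul, star_one_div_two_pi, matIntegral_map_star_eq_self fun ν => ?_]
  simp only [map_star_mul, gramKernel_map_star, res_map_star, weight_map_star]
  simp

theorem Yₖω_conjTranspose : (G.Yₖω ω R)ᴴ = G.Yₖω ω R := by
  conv_rhs => rw [Yₖω, ← gramY_conjTranspose]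
  rfl

theorem Zₖω_conjTranspose (hG : G.IsAdmissible) (hR : R.IsAdmissible) :
    (G.Zₖω ω R)ᴴ = G.Zₖω ω R := by
  conv_rhs => rw [Zₖω, ← gramZ_conjTranspose ω (isAdmissible_err hG hR).2]
  rfl

/-- The adjoint of the sensitivity to the reduced state matrix, in the form of the first
optimality condition. -/
theorem stateSens_err_conjTranspose (hG : G.IsAdmissible) (hR : R.IsAdmissible) :
    (((G.err R).stateSens ω).toBlocks₂₂)ᴴ =
      -((G.Y₁₂ω ω R + 2 • G.Z₁₂ω ω R)ᴴ * G.P₁₂ω ω R) +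
        (G.Yₖω ω R + 2 • G.Zₖω ω R) * G.Pₖω ω R + G.Lω ω R := by
  have hP : (G.P₁₂ R)ᵀᴴ = G.P₁₂ R := by
    rw [← conjTranspose_eq_transpose_of_map_star (P₁₂_map_star hG.1 hR.1),
      Matrix.conjTranspose_conjTranspose]
  -- The products of two frequency-limited matrices in `L_ω` cancel against the `Y + 2 Z` terms,
  -- leaving only `Q₁₂ᴴ P₁₂`, `Z̄₁₂ᴴ P_{12,ω}`, their `k`-counterparts and `Wᴴ`.
  rw [stateSens_err_toBlocks₂₂_eq ω hG.1 hR.1, Lω, Q₁₂ω, Qₖω]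
  simp only [Matrix.conjTranspose_add, Matrix.conjTranspose_sub, Matrix.conjTranspose_mul,
    Matrix.conjTranspose_neg, Matrix.conjTranspose_conjTranspose, hP, Pₖ_conjTranspose hR.1,
    Pₖω_conjTranspose, Zbarₖ_conjTranspose ω hR, Yₖω_conjTranspose,
    Zₖω_conjTranspose ω hG hR, two_smul, Matrix.add_mul, Matrix.mul_add, Matrix.sub_mul,
    Matrix.mul_sub, Matrix.neg_mul, Matrix.mul_neg]
  abel

end Gradient

/-! ### Stationarity -/

section Components

variable {ι μ o : Type*} (X : Matrix ι ι ℝ) (Y : Matrix ι μ ℝ) (Z : Matrix o ι ℝ)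
  (N : o → Matrix ι ι ℝ)

@[simp] theorem A_mk : A (X, Y, Z, N) = X := rfl

@[simp] theorem B_mk : B (X, Y, Z, N) = Y := rfl

@[simp] theorem C_mk : C (X, Y, Z, N) = Z := rfl

@[simp] theorem M_mk (i : o) : M (X, Y, Z, N) i = N i := rfl

end Components

section Stationarity

variable {ι κ μ o : Type*} [Fintype ι] [DecidableEq ι] [Fintype κ] [DecidableEq κ] [Fintype μ]
  [Fintype o] {ω : ℝ} {G : LQOSystem ι μ o} {R : LQOSystem κ μ o}

/-- At a local extremum all directional derivatives of the squared error norm vanish. -/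
theorem directional_deriv_eq_zero (hω : 0 ≤ ω) (hG : G.IsAdmissible) (hR : R.IsAdmissible)
    (hopt : IsLocalExtrOn (fun S : LQOSystem κ μ o => ((G.err S).h2Norm ω) ^ 2)
      {S | S.IsAdmissible} R) {H : LQOSystem κ μ o} (hH : ∀ i, (H.M i).IsSymm) :
    ((toC H.A * ((G.err R).stateSens ω).toBlocks₂₂).trace +
      (toC H.B * (-((G.Y₁₂ω ω R + 2 • G.Z₁₂ω ω R)ᴴ * toC G.B) +
        (G.Yₖω ω R + 2 • G.Zₖω ω R) * toC R.B)ᴴ).trace +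
      (toC H.C * (-(toC G.C * G.P₁₂ω ω R) + toC R.C * G.Pₖω ω R)ᴴ).trace +
      ∑ i, (toC (H.M i) * (-((G.P₁₂ω ω R)ᴴ * toC (G.M i) * G.P₁₂ω ω R) +
        G.Pₖω ω R * toC (R.M i) * G.Pₖω ω R)).trace).re = 0 := by
  have hS := isAdmissible_err hG hR
  set H' : LQOSystem (ι ⊕ κ) μ o := (0 : LQOSystem ι μ o).err H with hH'
  have hH's : ∀ i, (H'.M i).IsSymm := fun i =>
    Matrix.IsSymm.fromBlocks (Matrix.isSymm_zero) (by simp)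
      (show (-H.M i)ᵀ = -H.M i by rw [Matrix.transpose_neg, (hH i).eq])
  have hderiv := hasDerivAt_h2Norm_sq hω hS hH's
  -- Since the direction has symmetric quadratic parts, the line stays admissible on both sides of
  -- `t = 0`; the constrained extremum thus gives a two-sided one in `t`.
  have hγ : Filter.Tendsto (fun t : ℝ => R + t • H) (nhds 0)
      (nhdsWithin R {S | S.IsAdmissible}) := by
    refine tendsto_nhdsWithin_iff.2 ⟨?_, ?_⟩
    · have hc : Continuous fun t : ℝ => R + t • H := by fun_prop
      have := hc.tendsto 0
      rwa [zero_smul, add_zero] at this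
    · filter_upwards [hR.1.eventually H.A] with t ht
      exact ⟨ht, fun i => (hR.2 i).add ((hH i).smul t)⟩
  have h0 : R + (0 : ℝ) • H = R := by rw [zero_smul, add_zero]
  have hext : IsLocalExtr (fun t : ℝ => ((G.err R + t • H').h2Norm ω) ^ 2) 0 := by
    have hopt' : IsExtrFilter (fun S : LQOSystem κ μ o => ((G.err S).h2Norm ω) ^ 2)
      (nhdsWithin R {S | S.IsAdmissible}) (R + (0 : ℝ) • H) := by
      rw [h0]
      exact hopt
    have h := hopt'.comp_tendsto (g := fun t : ℝ => R + t • H) hγ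
    simp only [hH', ← err_add_smul]
    exact h
  have hzero := hext.hasDerivAt_eq_zero hderiv
  have hre := (mul_eq_zero.1 hzero).resolve_left two_ne_zero
  have hA : toC H'.A = Matrix.fromBlocks 0 0 0 (toC H.A) := by
    ext (i | i) (j | j) <;> simp [hH', err, A]
  have hB : toC H'.B = Matrix.fromRows 0 (toC H.B) := by
    ext (i | i) j <;> simp [hH', err, B]
  have hC : toC H'.C = Matrix.fromCols 0 (-toC H.C) := by
    ext i (j | j) <;> simp [hH', err, C]
  have hM : ∀ i, toC (H'.M i) = Matrix.fromBlocks 0 0 0 (-toC (H.M i)) := fun i => by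
    ext (i | i) (j | j) <;> simp [hH', err, M]
  have eA : (toC H'.A * (G.err R).stateSens ω).trace =
      (toC H.A * ((G.err R).stateSens ω).toBlocks₂₂).trace := by
    conv_lhs => rw [← Matrix.fromBlocks_toBlocks ((G.err R).stateSens ω)]
    rw [hA, Matrix.fromBlocks_multiply, trace_fromBlocks]
    simp
  have hYZ₁₂ : ((G.err R).gramY ω + 2 • (G.err R).gramZ ω).toBlocks₁₂ =
      -(G.Y₁₂ω ω R + 2 • G.Z₁₂ω ω R) := by
    rw [Y₁₂ω, Z₁₂ω, two_smul, two_smul, ← neg_add, ← neg_add, neg_neg]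
    rfl
  have hYZ₂₂ : ((G.err R).gramY ω + 2 • (G.err R).gramZ ω).toBlocks₂₂ =
      G.Yₖω ω R + 2 • G.Zₖω ω R := by
    rw [two_smul, two_smul]
    rfl
  have eB : (toC H'.B * (toC (G.err R).Bᵀ * ((G.err R).gramY ω + 2 • (G.err R).gramZ ω))).trace =
      (toC H.B * (-((G.Y₁₂ω ω R + 2 • G.Z₁₂ω ω R)ᴴ * toC G.B) +
        (G.Yₖω ω R + 2 • G.Zₖω ω R) * toC R.B)ᴴ).trace := by
    have hT : (G.Yₖω ω R + 2 • G.Zₖω ω R)ᴴ = G.Yₖω ω R + 2 • G.Zₖω ω R := by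
      simp only [two_smul, Matrix.conjTranspose_add, Yₖω_conjTranspose,
        Zₖω_conjTranspose ω hG hR]
    rw [← Matrix.fromBlocks_toBlocks ((G.err R).gramY ω + 2 • (G.err R).gramZ ω), hYZ₁₂, hYZ₂₂,
      hB, toC_B_err_transpose, Matrix.fromCols_mul_fromBlocks, Matrix.fromRows_mul_fromCols,
      trace_fromBlocks, Matrix.conjTranspose_add, Matrix.conjTranspose_neg,
      Matrix.conjTranspose_mul, Matrix.conjTranspose_mul, hT, Matrix.conjTranspose_conjTranspose,
      toC_conjTranspose, toC_conjTranspose, Matrix.zero_mul, Matrix.trace_zero, zero_add,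
      Matrix.mul_neg]
  have eC : (toC H'.C * ((G.err R).gramP ω * toC (G.err R).Cᵀ)).trace =
      (toC H.C * (-(toC G.C * G.P₁₂ω ω R) + toC R.C * G.Pₖω ω R)ᴴ).trace := by
    rw [gramP_err, hC, toC_C_err_transpose, Matrix.fromBlocks_mul_fromRows,
      Matrix.fromCols_mul_fromRows, Matrix.conjTranspose_add, Matrix.conjTranspose_neg,
      Matrix.conjTranspose_mul, Matrix.conjTranspose_mul, Pₖω_conjTranspose, toC_conjTranspose,
      toC_conjTranspose, Matrix.zero_mul, zero_add, Matrix.mul_neg, Matrix.neg_mul,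
      ← Matrix.mul_neg, neg_add, neg_neg]
  have eM : ∀ i, (toC (H'.M i) * ((G.err R).gramP ω * toC ((G.err R).M i) *
      (G.err R).gramP ω)).trace =
      (toC (H.M i) * (-((G.P₁₂ω ω R)ᴴ * toC (G.M i) * G.P₁₂ω ω R) +
        G.Pₖω ω R * toC (R.M i) * G.Pₖω ω R)).trace := fun i => by
    rw [gramP_err, hM, toC_M_err, Matrix.fromBlocks_multiply, Matrix.fromBlocks_multiply,
      Matrix.fromBlocks_multiply, trace_fromBlocks]
    simp only [Matrix.mul_zero, Matrix.zero_mul, add_zero, zero_add, Matrix.trace_zero, neg_zero,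
      Matrix.mul_neg, Matrix.neg_mul, Matrix.mul_add, neg_neg]
  rw [eA, eB, eC, Finset.sum_congr rfl fun i _ => eM i] at hre
  exact hre

end Stationarity

end LQOSystem

/-! ### The optimality conditions from test directions -/

theorem theorem1 (n k m p : ℕ) (ω : ℝ) (hω : 0 < ω)
    (G : LQOSystem (Fin n) (Fin m) (Fin p)) (hG : G.IsAdmissible)
    (R : LQOSystem (Fin k) (Fin m) (Fin p)) (hR : R.IsAdmissible)
    (hopt : IsLocalExtrOn
      (fun S : LQOSystem (Fin k) (Fin m) (Fin p) => (LQOSystem.h2Norm ω (G.err S)) ^ 2)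
      {S | S.IsAdmissible} R) :
    -((G.Y₁₂ω ω R + 2 • G.Z₁₂ω ω R).conjTranspose * G.P₁₂ω ω R)
        + (G.Yₖω ω R + 2 • G.Zₖω ω R) * G.Pₖω ω R + G.Lω ω R = 0 ∧
    (∀ i, -((G.P₁₂ω ω R).conjTranspose * toC (G.M i) * G.P₁₂ω ω R)
        + G.Pₖω ω R * toC (R.M i) * G.Pₖω ω R = 0) ∧
    -((G.Y₁₂ω ω R + 2 • G.Z₁₂ω ω R).conjTranspose * toC G.B)
        + (G.Yₖω ω R + 2 • G.Zₖω ω R) * toC R.B = 0 ∧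
    -(toC G.C * G.P₁₂ω ω R) + toC R.C * G.Pₖω ω R = 0 := by
  have hY₁₂ : (G.Y₁₂ω ω R).map star = G.Y₁₂ω ω R := by
    rw [LQOSystem.Y₁₂ω, map_star_neg]
    exact congrArg (fun X => -Matrix.toBlocks₁₂ X) ((G.err R).gramY_map_star ω)
  have hZ₁₂ : (G.Z₁₂ω ω R).map star = G.Z₁₂ω ω R := by
    rw [LQOSystem.Z₁₂ω, map_star_neg]
    exact congrArg (fun X => -Matrix.toBlocks₁₂ X) ((G.err R).gramZ_map_star ω)
  have hYₖ : (G.Yₖω ω R).map star = G.Yₖω ω R :=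
    congrArg Matrix.toBlocks₂₂ ((G.err R).gramY_map_star ω)
  have hZₖ : (G.Zₖω ω R).map star = G.Zₖω ω R :=
    congrArg Matrix.toBlocks₂₂ ((G.err R).gramZ_map_star ω)
  have hΞ : ((G.err R).stateSens ω).toBlocks₂₂.map star = ((G.err R).stateSens ω).toBlocks₂₂ :=
    congrArg Matrix.toBlocks₂₂ ((G.err R).stateSens_map_star ω)
  have hP₁₂ := G.P₁₂ω_map_star ω R
  have hPₖ := G.Pₖω_map_star ω R
  have hdir := fun H : LQOSystem (Fin k) (Fin m) (Fin p) =>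
    LQOSystem.directional_deriv_eq_zero (H := H) hω.le hG hR hopt
  refine ⟨?_, fun i => ?_, ?_, ?_⟩
  · rw [← LQOSystem.stateSens_err_conjTranspose ω hG hR, Matrix.conjTranspose_eq_zero]
    refine eq_zero_of_re_trace hΞ ?_
    -- The direction is the transpose of the gradient, so the vanishing derivative is its squared
    -- Frobenius norm.
    have h := hdir ((((G.err R).stateSens ω).toBlocks₂₂.map Complex.re)ᵀ, 0, 0, 0)
      fun i => Matrix.isSymm_zero
    simpa using h
  · set X := -((G.P₁₂ω ω R)ᴴ * toC (G.M i) * G.P₁₂ω ω R) +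
      G.Pₖω ω R * toC (R.M i) * G.Pₖω ω R with hX
    have hXr : X.map star = X := by
      simp only [hX, map_star_add, map_star_neg, map_star_mul, map_star_conjTranspose, hP₁₂, hPₖ,
        toC_map_star]
    have hXs : Xᴴ = X := by
      simp only [hX, Matrix.conjTranspose_add, Matrix.conjTranspose_neg, Matrix.conjTranspose_mul,
        Matrix.conjTranspose_conjTranspose, G.Pₖω_conjTranspose, toC_conjTranspose, (hG.2 i).eq,
        (hR.2 i).eq, Matrix.mul_assoc]
    refine eq_zero_of_re_trace hXr ?_
    -- Only symmetric perturbations of `M_{k,i}` are allowed; the gradient is itself symmetric, so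
    -- it is still an admissible test direction.
    have hsymm : ((X.map Complex.re)ᵀ).IsSymm := by
      ext a b
      have := congrArg Complex.re (congrFun (congrFun hXs a) b)
      simpa using this.symm
    have h := hdir (0, 0, 0, Pi.single i (X.map Complex.re)ᵀ) fun j => by
      rcases eq_or_ne j i with rfl | hj
      · simpa using hsymm
      · simp [hj]
    rw [Finset.sum_eq_single i (fun j _ hj => by simp [hj]) (by simp)] at h
    simpa [← hX] using h
  · set X := -((G.Y₁₂ω ω R + 2 • G.Z₁₂ω ω R)ᴴ * toC G.B) +
      (G.Yₖω ω R + 2 • G.Zₖω ω R) * toC R.B with hX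
    have hXr : X.map star = X := by
      simp only [hX, map_star_add, map_star_neg, map_star_mul, map_star_conjTranspose, two_smul,
        hY₁₂, hZ₁₂, hYₖ, hZₖ, toC_map_star]
    -- The derivative pairs `H.B` with the adjoint of the desired expression, so it is the adjoint
    -- that is tested against itself; the same holds for `H.C` below.
    rw [← Matrix.conjTranspose_eq_zero]
    have hXr' : Xᴴ.map star = Xᴴ := by rw [map_star_conjTranspose, hXr]
    refine eq_zero_of_re_trace hXr' ?_
    have h := hdir (0, (Xᴴ.map Complex.re)ᵀ, 0, 0) fun i => Matrix.isSymm_zero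
    simpa using h
  · set X := -(toC G.C * G.P₁₂ω ω R) + toC R.C * G.Pₖω ω R with hX
    have hXr : X.map star = X := by
      simp only [hX, map_star_add, map_star_neg, map_star_mul, hP₁₂, hPₖ, toC_map_star]
    rw [← Matrix.conjTranspose_eq_zero]
    have hXr' : Xᴴ.map star = Xᴴ := by rw [map_star_conjTranspose, hXr]
    refine eq_zero_of_re_trace hXr' ?_
    have h := hdir (0, 0, (Xᴴ.map Complex.re)ᵀ, 0) fun i => Matrix.isSymm_zero
    simpa using h
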